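/- **Theorem.** An instance of *Edge Clique Cover parameterized by treewidth* is a finite simple graph $G$ together with a tree decomposition of $G$ of width $\ell$; the parameter is $\ell$. A solution is a family $S$ of vertex sets, each inducing a clique of $G$, such that for every edge $uv$ of $G$ some $C\in S$ contains both $u$ and $v$; its value is $|S|$, to be minimized. Instances and solutions are encoded as words; solutions of $(I,k)$ are required to have length at most $|I|+k$, and $\mathrm{OPT}(I,k)$ is the minimum value of a solution. A solution is $r$-approximate if its value is at most $r\cdot\mathrm{OPT}(I,k)$. For $\alpha\ge 1$, an *$\alpha$-approximate Turing kernel* is an algorithm, independent of $c$, that for every real $c\ge 1$, when given access to an oracle that answers instances of the problem with $c$-approximate solutions in a single step, on every instance $(I,k)$ runs in time polynomial in $|I|+k$, outputs an $\alpha c$-approximate solution of $(I,k)$, and queries the oracle only on instances whose size (encoding length and parameter) is bounded by a function of $k$. There is an absolute constant $C$ such that for every real $0<\varepsilon\le 1$, Edge Clique Cover parameterized by treewidth has a $(1+\varepsilon)$-approximate Turing kernel which, on an instance with a tree decomposition of width $\ell$, queries the oracle only on instances whose graph has at most $C\,\ell^4/\varepsilon$ vertices and whose encoding length and parameter are bounded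 by a polynomial in $\ell$ (the polynomial may depend on $\varepsilon$). -/

import Mathlib

/-! ## Words, programs with an oracle, and running time -/

namespace TuringKernel

/-- The words that programs work on: binary trees, i.e. well-parenthesised strings. -/
inductive Datum : Type
  | nil : Datum
  | cons : Datum → Datum → Datum

namespace Datum

/-- The length of a word: the number of nodes of the tree. -/
def size : Datum → ℕ
  | nil => 1
  | cons a b => a.size + b.size + 1

/-- Natural numbers are written in unary. -/
def ofNat : ℕ → Datum
  | 0 => nil
  | n + 1 => cons nil (ofNat n)

/-- A list is written as a right comb. -/
def ofList {α : Type} (enc : α → Datum) : List α → Datum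
  | [] => nil
  | a :: l => cons (enc a) (ofList enc l)

/-- First component of a pair. -/
def fst : Datum → Datum
  | nil => nil
  | cons a _ => a

/-- Second component of a pair. -/
def snd : Datum → Datum
  | nil => nil
  | cons _ b => b

end Datum

open Datum in
/-- The word handed to a program (or to an oracle) for the pair `(I, k)`. -/
def input (I : Datum) (k : ℕ) : Datum := cons I (ofNat k)

/-- Programs of a small while-language over words, with one instruction that calls an oracle. -/
inductive Prog : Type
  | id : Prog
  | nil : Prog
  | fst : Prog
  | snd : Prog
  /-- equality test for the two components of a pair -/
  | eq : Prog
  /-- run two programs on the same word and form the pair of their results -/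
  | pair : Prog → Prog → Prog
  /-- `comp g f` runs `f`, then `g` on the result of `f` -/
  | comp : Prog → Prog → Prog
  /-- `ite b f g` runs `f` if `b` yields a word other than `nil`, and `g` otherwise -/
  | ite : Prog → Prog → Prog → Prog
  /-- `loop b f` applies `f` as long as `b` yields a word other than `nil` -/
  | loop : Prog → Prog → Prog
  /-- replace the current word by the answer of the oracle to it -/
  | query : Prog

open Datum in
/-- `Runs O A p x y t`: with oracle `O`, the program `p` started on `x` halts with result `y` after
`t` units of time, and every query that it makes on the way satisfies `A`.

Every instruction costs one unit plus the length of each word that it reads or copies, so that the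
running time is polynomially related to that of an (oracle) Turing machine. The oracle answers at
once; only reading the query and the answer is charged. -/
inductive Runs (O : Datum → Datum) (A : Datum → Prop) : Prog → Datum → Datum → ℕ → Prop
  | id (x : Datum) : Runs O A .id x x (x.size + 1)
  | nil (x : Datum) : Runs O A .nil x .nil (x.size + 1)
  | fst (x : Datum) : Runs O A .fst x x.fst (x.size + 1)
  | snd (x : Datum) : Runs O A .snd x x.snd (x.size + 1)
  | eq_true (x : Datum) : x.fst = x.snd → Runs O A .eq x (.cons .nil .nil) (x.size + 3)
  | eq_false (x : Datum) : x.fst ≠ x.snd → Runs O A .eq x .nil (x.size + 3)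
  | pair {f g : Prog} {x y z : Datum} {s t : ℕ} :
      Runs O A f x y s → Runs O A g x z t →
      Runs O A (.pair f g) x (.cons y z) (s + t + x.size + 1)
  | comp {f g : Prog} {x y z : Datum} {s t : ℕ} :
      Runs O A f x y s → Runs O A g y z t → Runs O A (.comp g f) x z (s + t + 1)
  | ite_true {b f g : Prog} {x w y : Datum} {s t : ℕ} :
      Runs O A b x w s → w ≠ .nil → Runs O A f x y t →
      Runs O A (.ite b f g) x y (s + t + x.size + 1)
  | ite_false {b f g : Prog} {x y : Datum} {s t : ℕ} :
      Runs O A b x .nil s → Runs O A g x y t →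
      Runs O A (.ite b f g) x y (s + t + x.size + 1)
  | loop_stop {b f : Prog} {x : Datum} {s : ℕ} :
      Runs O A b x .nil s → Runs O A (.loop b f) x x (s + x.size + 1)
  | loop_step {b f : Prog} {x w y z : Datum} {s t r : ℕ} :
      Runs O A b x w s → w ≠ .nil → Runs O A f x y t → Runs O A (.loop b f) y z r →
      Runs O A (.loop b f) x z (s + t + r + x.size + 1)
  | query (x : Datum) : A x → Runs O A .query x (O x) (x.size + (O x).size + 1)

/-! ## Parameterized minimization problems and approximate Turing kernels -/

/-- A parameterized minimization problem: which pairs `(I, k)` are (well-formed) instances, and the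
value of a word `s` as a candidate solution for `(I, k)`; the value `⊤` means `s` is infeasible. -/
structure MinProblem : Type where
  IsInstance : Datum → ℕ → Prop
  value : Datum → ℕ → Datum → EReal

/-- The optimum is taken over all words of length at most `|I| + k`. -/
noncomputable def MinProblem.opt (Q : MinProblem) (I : Datum) (k : ℕ) : EReal :=
  sInf {r | ∃ s : Datum, s.size ≤ I.size + k ∧ r = Q.value I k s}

/-- `s` is an `r`-approximate solution for the instance `(I, k)`. -/
def MinProblem.IsApproxSolution (Q : MinProblem) (r : ℝ) (I : Datum) (k : ℕ) (s : Datum) : Prop :=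
  s.size ≤ I.size + k ∧ Q.value I k s ≤ (r : EReal) * Q.opt I k

/-- The oracle `O` answers every instance of `Q` with a `c`-approximate solution. -/
def MinProblem.IsApproxOracle (Q : MinProblem) (c : ℝ) (O : Datum → Datum) : Prop :=
  ∀ I k, Q.IsInstance I k → Q.IsApproxSolution c I k (O (input I k))

/-- `p` is an `α`-approximate Turing kernel for `Q`, whose queries on inputs of parameter `k` are
instances `(I', k')` with `small k I' k'`. The program `p` and its polynomial time bound depend
neither on `c` nor on the oracle. -/
def IsApproxTuringKernel (Q : MinProblem) (α : ℝ) (small : ℕ → Datum → ℕ → Prop)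
    (p : Prog) : Prop :=
  ∃ P : Polynomial ℕ, ∀ c : ℝ, 1 ≤ c → ∀ O : Datum → Datum, Q.IsApproxOracle c O →
    ∀ (I : Datum) (k : ℕ), Q.IsInstance I k →
      ∃ (s : Datum) (t : ℕ),
        Runs O (fun q => ∃ I' k', q = input I' k' ∧ Q.IsInstance I' k' ∧ small k I' k')
          p (input I k) s t ∧
        t ≤ P.eval (I.size + k) ∧
        Q.IsApproxSolution (α * c) I k s

/-! ## Tree decompositions and edge clique covers -/

/-- `(T, X)` is a tree decomposition of the graph `G`. -/
structure IsTreeDecomposition {V ι : Type} (G : SimpleGraph V) (T : SimpleGraph ι)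
    (X : ι → Finset V) : Prop where
  isTree : T.IsTree
  vertex_mem : ∀ v, ∃ t, v ∈ X t
  edge_mem : ∀ u v, G.Adj u v → ∃ t, u ∈ X t ∧ v ∈ X t
  connected : ∀ v, (T.induce {t | v ∈ X t}).Connected

/-- The width: the size of the largest bag minus one (and `0` if all bags are empty). -/
def width {V ι : Type} [Fintype ι] (X : ι → Finset V) : ℕ :=
  (Finset.univ.sup fun t => (X t).card) - 1

/-- A family of vertex sets is an edge clique cover of `G`. -/
structure IsEdgeCliqueCover {V : Type} (G : SimpleGraph V) (S : List (Finset V)) : Prop where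
  isClique : ∀ C ∈ S, G.IsClique (C : Set V)
  cover : ∀ u v, G.Adj u v → ∃ C ∈ S, u ∈ C ∧ v ∈ C

/-! ## The problem Edge Clique Cover parameterized by treewidth -/

/-- The graph on `{0, …, n - 1}` with the listed edges. -/
def listGraph (n : ℕ) (E : List (ℕ × ℕ)) : SimpleGraph (Fin n) :=
  SimpleGraph.fromRel fun u v => (u.val, v.val) ∈ E

/-- `E` lists edges of a simple graph on `{0, …, n - 1}`, each of them once. -/
def IsEdgeList (n : ℕ) (E : List (ℕ × ℕ)) : Prop :=
  E.Nodup ∧ ∀ e ∈ E, e.1 < e.2 ∧ e.2 < n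

/-- The set of vertices in `{0, …, n - 1}` that occur in a list. -/
def listSet (n : ℕ) (l : List ℕ) : Finset (Fin n) :=
  Finset.univ.filter fun v => v.val ∈ l

/-- A graph on `{0, …, n - 1}`, given by its edges, with a tree decomposition, given by the list of
its bags and the list `links` of edges of the tree (a node is a position in the list of bags). -/
structure GraphWithDecomposition : Type where
  n : ℕ
  edges : List (ℕ × ℕ)
  bags : List (List ℕ)
  links : List (ℕ × ℕ)

namespace GraphWithDecomposition

def graph (x : GraphWithDecomposition) : SimpleGraph (Fin x.n) := listGraph x.n x.edges

def tree (x : GraphWithDecomposition) : SimpleGraph (Fin x.bags.length) :=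
  listGraph x.bags.length x.links

def bag (x : GraphWithDecomposition) (t : Fin x.bags.length) : Finset (Fin x.n) :=
  listSet x.n (x.bags.get t)

/-- The lists describe a graph together with a tree decomposition of width `ℓ` of it. -/
structure Valid (x : GraphWithDecomposition) (ℓ : ℕ) : Prop where
  edges_ok : IsEdgeList x.n x.edges
  bags_ok : ∀ b ∈ x.bags, b.Nodup ∧ ∀ v ∈ b, v < x.n
  links_ok : IsEdgeList x.bags.length x.links
  decomposition : IsTreeDecomposition x.graph x.tree x.bag
  width_eq : width x.bag = ℓ

open Datum in
/-- The word that describes `x`; an edge is written as the list of its two ends. -/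
def encode (x : GraphWithDecomposition) : Datum :=
  let edge : ℕ × ℕ → Datum := fun e => ofList ofNat [e.1, e.2]
  cons (ofNat x.n)
    (cons (ofList edge x.edges) (cons (ofList (ofList ofNat) x.bags) (ofList edge x.links)))

end GraphWithDecomposition

/-- Edge Clique Cover parameterized by treewidth: an instance is a graph with a tree decomposition
of width `ℓ`, and `ℓ` is the parameter; a solution is a list of vertex sets that is an edge clique
cover, and its value is the number of sets in the list. -/
noncomputable def edgeCliqueCover : MinProblem where
  IsInstance I ℓ := ∃ x : GraphWithDecomposition, I = x.encode ∧ x.Valid ℓ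
  value I ℓ s := sInf {r | ∃ (x : GraphWithDecomposition) (L : List (List ℕ)),
    I = x.encode ∧ x.Valid ℓ ∧ s = Datum.ofList (Datum.ofList Datum.ofNat) L ∧
    (∀ C ∈ L, ∀ v ∈ C, v < x.n) ∧
    IsEdgeCliqueCover x.graph (L.map (listSet x.n)) ∧
    r = (L.length : EReal)}

end TuringKernel

namespace TuringKernel

/-! ## Polynomial-time functions -/

/-! Isolated vertices never matter, so only the core, the set of non-isolated vertices, is split.
Every clique lies in one bag (`RunningIntersection.exists_subset`), hence covers at most ℓ+1 core
vertices. Since every core vertex has an edge to be covered, the core has at most (ℓ+1)·OPT vertices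
(`Valid.length_core_le`).

The tree is processed from the leaves to the root. The set collected at a node is merged into its
parent, and as soon as M vertices have gathered they are cut off as a piece, only the bag of the
parent staying behind (`carve_spec`). Two sets below M were merged, so a piece has at most 2M
vertices. It shares at most b = ℓ+1 vertices with the rest, and every edge lies on one side. With M
≥ m+b each cut removes at least m vertices, so the number q of cuts satisfies q·m ≤ |core|
(`SplitsInto.length_mul_le`).

A cut is cheap: a clique lies on one of the two sides, so an optimal cover can be distributed, and
only edges inside the overlap may be lost on a side. There are at most b² of them, and covering each
by itself on both sides costs 2b² cliques. The optima of the pieces thus add up to at most OPT +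
2b²q (`SplitsInto.sum_coverNumber_le`). For m = 2ab³ the bound on the core gives 2b²q ≤ OPT/a, and a
= ⌈1/ε⌉ makes the sum at most (1+ε)·OPT. A c-approximate answer for every piece therefore yields a
(1+ε)c-approximate cover. The pieces have O(ℓ³/ε) vertices, which is below the claimed bound.

Solutions must also be short words. `shrink` turns any cover into one that is no longer than the
edge list of the instance. The same operation shows that the length restriction does not change the
optimum (`opt_eq`).

The algorithm is a composition of list functions. The class `PolyTime` with its closure lemmas,
above all folds with controlled length, supplies the programs; only `exists_query_loop` calls the
oracle. -/

theorem eval_le_eval (P : Polynomial ℕ) {m n : ℕ} (h : m ≤ n) : P.eval m ≤ P.eval n := by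
  induction P using Polynomial.induction_on' with
  | add p q hp hq => simpa using Nat.add_le_add hp hq
  | monomial k a => simpa using Nat.mul_le_mul_left a (Nat.pow_le_pow_left h k)

namespace Datum

theorem one_le_size (x : Datum) : 1 ≤ x.size := by cases x <;> simp [size]

theorem fst_size_le (x : Datum) : x.fst.size ≤ x.size := by
  cases x <;> simp [size, fst]; omega

theorem snd_size_le (x : Datum) : x.snd.size ≤ x.size := by
  cases x <;> simp [size, snd]; omega

end Datum

/-- Writing the result is paid for, so time bounds also bound lengths. This is what lets polynomial
time bounds be composed. -/
theorem Runs.size_le {O : Datum → Datum} {A : Datum → Prop} {p : Prog} {x y : Datum} {t : ℕ}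
    (h : Runs O A p x y t) : y.size ≤ t := by
  induction h with
  | fst x => have := x.fst_size_le; omega
  | snd x => have := x.snd_size_le; omega
  | nil x => simp [Datum.size]
  | _ => first | omega | (simp_all [Datum.size] <;> omega)

/-- An encoding of a type by words. -/
class Enc (α : Type) where
  toDatum : α → Datum

/-- The word that encodes `a`. -/
def enc {α : Type} [Enc α] (a : α) : Datum := Enc.toDatum a

/-- The length of the encoding of `a`. -/
def len {α : Type} [Enc α] (a : α) : ℕ := (enc a).size

instance : Enc Datum := ⟨fun d => d⟩
instance : Enc Unit := ⟨fun _ => .nil⟩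
instance : Enc Bool := ⟨fun b => if b then .cons .nil .nil else .nil⟩
instance : Enc ℕ := ⟨Datum.ofNat⟩
instance {α β : Type} [Enc α] [Enc β] : Enc (α × β) := ⟨fun x => .cons (enc x.1) (enc x.2)⟩
instance {α : Type} [Enc α] : Enc (List α) := ⟨Datum.ofList enc⟩

/-! ### Lengths of encodings -/

section Len
variable {α β : Type} [Enc α] [Enc β]

theorem enc_nil : enc ([] : List α) = .nil := rfl
theorem enc_cons (a : α) (l : List α) : enc (a :: l) = .cons (enc a) (enc l) := rfl
theorem enc_pair (a : α) (b : β) : enc (a, b) = .cons (enc a) (enc b) := rfl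
theorem one_le_len (a : α) : 1 ≤ len a := Datum.one_le_size _
@[simp] theorem len_nil : len ([] : List α) = 1 := rfl
@[simp] theorem len_cons (a : α) (l : List α) : len (a :: l) = len a + len l + 1 := rfl
@[simp] theorem len_pair (a : α) (b : β) : len (a, b) = len a + len b + 1 := rfl
@[simp] theorem len_nat (n : ℕ) : len n = 2 * n + 1 := by
  induction n with
  | zero => rfl
  | succ n ih =>
    have : len (n + 1) = 1 + len n + 1 := rfl
    omega

theorem length_le_len (l : List α) : l.length ≤ len l := by
  induction l with
  | nil => simp
  | cons a l ih => simp; omega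

theorem len_append (l m : List α) : len (l ++ m) + 1 = len l + len m := by
  induction l with
  | nil => simp [add_comm]
  | cons a l ih => simp; omega

theorem len_sublist {l m : List α} (h : l.Sublist m) : len l ≤ len m := by
  induction h with
  | slnil => simp
  | cons a _ ih => simp; omega
  | cons_cons a _ ih => simp; omega

theorem len_mem {a : α} {l : List α} (h : a ∈ l) : len a ≤ len l := by
  induction l with
  | nil => simp at h
  | cons b l ih =>
    rcases List.mem_cons.1 h with rfl | h
    · simp; omega
    · have := ih h
      simp; omega

theorem len_le_of_forall {l : List α} {k : ℕ} (h : ∀ a ∈ l, len a ≤ k) :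
    len l ≤ 1 + l.length * (k + 1) := by
  induction l with
  | nil => simp
  | cons a l ih =>
    have h1 := h a (by simp)
    have h2 := ih fun b hb => h b (by simp [hb])
    simp [add_mul]; omega

end Len

/-- A program computes `f` in polynomial time and without queries. -/
@[fun_prop]
def PolyTime {α β : Type} [Enc α] [Enc β] (f : α → β) : Prop :=
  ∃ (p : Prog) (P : Polynomial ℕ), ∀ (O : Datum → Datum) (A : Datum → Prop) (a : α),
    ∃ t, Runs O A p (enc a) (enc (f a)) t ∧ t ≤ P.eval (len a)

namespace PolyTime

variable {α β γ δ σ : Type} [Enc α] [Enc β] [Enc γ] [Enc δ] [Enc σ]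

theorem exists_len_le {f : α → β} (hf : PolyTime f) :
    ∃ P : Polynomial ℕ, ∀ a, len (f a) ≤ P.eval (len a) := by
  obtain ⟨p, P, h⟩ := hf
  refine ⟨P, fun a => ?_⟩
  obtain ⟨t, ht, htP⟩ := h (fun x => x) (fun _ => True) a
  exact ht.size_le.trans htP

theorem of_enc_eq {f : α → β} (h : ∀ a, enc (f a) = enc a) : PolyTime f :=
  ⟨.id, .X + 1, fun O A a => ⟨len a + 1, by rw [h a]; exact Runs.id _, by simp⟩⟩

theorem of_eq {f g : α → β} (hf : PolyTime f) (h : ∀ a, g a = f a) : PolyTime g :=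
  funext h ▸ hf

theorem congr_enc {f : α → β} {g : α → γ} (hf : PolyTime f) (h : ∀ a, enc (g a) = enc (f a)) :
    PolyTime g := by
  obtain ⟨p, P, hp⟩ := hf
  exact ⟨p, P, fun O A a => (h a).symm ▸ hp O A a⟩

@[fun_prop]
theorem id' : PolyTime (fun a : α => a) := of_enc_eq fun _ => rfl

@[fun_prop]
theorem comp {g : β → γ} {f : α → β} (hg : PolyTime g) (hf : PolyTime f) :
    PolyTime (fun a => g (f a)) := by
  obtain ⟨p, P, hp⟩ := hf
  obtain ⟨q, Q, hq⟩ := hg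
  refine ⟨.comp q p, P + Q.comp P + 1, fun O A a => ?_⟩
  obtain ⟨s, hs, hsP⟩ := hp O A a
  obtain ⟨t, ht, htQ⟩ := hq O A (f a)
  refine ⟨_, hs.comp ht, ?_⟩
  have : Q.eval (len (f a)) ≤ Q.eval (P.eval (len a)) := eval_le_eval Q (hs.size_le.trans hsP)
  simp only [Polynomial.eval_add, Polynomial.eval_comp, Polynomial.eval_one]
  omega

theorem datum_fst {f : δ → α} (hf : PolyTime f) : PolyTime (fun x => (enc (f x)).fst) :=
  comp (g := fun a => (enc a).fst)
    ⟨.fst, .X + 1, fun O A a => ⟨len a + 1, Runs.fst _, by simp⟩⟩ hf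

theorem datum_snd {f : δ → α} (hf : PolyTime f) : PolyTime (fun x => (enc (f x)).snd) :=
  comp (g := fun a => (enc a).snd)
    ⟨.snd, .X + 1, fun O A a => ⟨len a + 1, Runs.snd _, by simp⟩⟩ hf

@[fun_prop]
theorem fst {f : δ → α × β} (hf : PolyTime f) : PolyTime (fun x => (f x).1) :=
  (datum_fst hf).congr_enc fun _ => rfl

@[fun_prop]
theorem snd {f : δ → α × β} (hf : PolyTime f) : PolyTime (fun x => (f x).2) :=
  (datum_snd hf).congr_enc fun _ => rfl

@[fun_prop]
theorem pair {f : δ → α} {g : δ → β} (hf : PolyTime f) (hg : PolyTime g) :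
    PolyTime (fun x => (f x, g x)) := by
  obtain ⟨p, P, hp⟩ := hf
  obtain ⟨q, Q, hq⟩ := hg
  refine ⟨.pair p q, P + Q + .X + 1, fun O A a => ?_⟩
  obtain ⟨s, hs, hsP⟩ := hp O A a
  obtain ⟨t, ht, htQ⟩ := hq O A a
  refine ⟨_, hs.pair ht, ?_⟩
  have : len a = (enc a).size := rfl
  simp; omega

theorem exists_const_prog (d : Datum) : ∃ (p : Prog) (P : Polynomial ℕ), ∀ O A x,
    ∃ t, Runs O A p x d t ∧ t ≤ P.eval x.size := by
  induction d with
  | nil => exact ⟨.nil, .X + 1, fun O A x => ⟨_, Runs.nil _, by simp⟩⟩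
  | cons a b iha ihb =>
    obtain ⟨p, P, hp⟩ := iha
    obtain ⟨q, Q, hq⟩ := ihb
    refine ⟨.pair p q, P + Q + .X + 1, fun O A x => ?_⟩
    obtain ⟨s, hs, hsP⟩ := hp O A x
    obtain ⟨t, ht, htQ⟩ := hq O A x
    exact ⟨_, hs.pair ht, by simp; omega⟩

@[fun_prop]
theorem const (b : β) : PolyTime (fun _ : α => b) := by
  obtain ⟨p, P, h⟩ := exists_const_prog (enc b)
  exact ⟨p, P, fun O A a => h O A (enc a)⟩

/-- Case distinction on the emptiness of a word. -/
theorem ite_of_enc {b : δ → γ} {f : δ → α} {g : δ → β} {h : δ → σ} (hb : PolyTime b) (hf : PolyTime f)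
    (hg : PolyTime g) (h1 : ∀ x, enc (b x) ≠ .nil → enc (h x) = enc (f x))
    (h2 : ∀ x, enc (b x) = .nil → enc (h x) = enc (g x)) : PolyTime h := by
  obtain ⟨r, R, hr⟩ := hb
  obtain ⟨p, P, hp⟩ := hf
  obtain ⟨q, Q, hq⟩ := hg
  refine ⟨.ite r p q, R + P + Q + .X + 1, fun O A a => ?_⟩
  obtain ⟨u, hu, huR⟩ := hr O A a
  obtain ⟨s, hs, hsP⟩ := hp O A a
  obtain ⟨t, ht, htQ⟩ := hq O A a
  have : len a = (enc a).size := rfl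
  by_cases hn : enc (b a) = .nil
  · rw [h2 a hn]
    exact ⟨_, .ite_false (hn ▸ hu) ht, by simp; omega⟩
  · rw [h1 a hn]
    exact ⟨_, .ite_true hu hn hs, by simp; omega⟩

theorem ite_bool {b : δ → Bool} {f g : δ → α} (hb : PolyTime b) (hf : PolyTime f)
    (hg : PolyTime g) : PolyTime (fun x => if b x then f x else g x) := by
  refine ite_of_enc hb hf hg (fun x hx => ?_) (fun x hx => ?_) <;>
  · cases h : b x <;> simp_all [enc, Enc.toDatum]

@[fun_prop]
theorem ite {p : δ → Prop} [DecidablePred p] {f g : δ → α} (hb : PolyTime (fun x => decide (p x)))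
    (hf : PolyTime f) (hg : PolyTime g) : PolyTime (fun x => if p x then f x else g x) := by
  simpa using ite_bool hb hf hg

@[fun_prop]
theorem and {a b : δ → Bool} (ha : PolyTime a) (hb : PolyTime b) :
    PolyTime (fun x => a x && b x) := by
  have := ite_bool ha hb (const false)
  refine (congrArg _ (funext fun x => ?_)).mp this
  cases a x <;> simp

@[fun_prop]
theorem or {a b : δ → Bool} (ha : PolyTime a) (hb : PolyTime b) :
    PolyTime (fun x => a x || b x) := by
  have := ite_bool ha (const true) hb
  refine (congrArg _ (funext fun x => ?_)).mp this
  cases a x <;> simp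

@[fun_prop]
theorem not {a : δ → Bool} (ha : PolyTime a) : PolyTime (fun x => !a x) := by
  have := ite_bool ha (const false) (const true)
  refine (congrArg _ (funext fun x => ?_)).mp this
  cases a x <;> simp

@[fun_prop]
theorem cons {f : δ → α} {g : δ → List α} (hf : PolyTime f) (hg : PolyTime g) :
    PolyTime (fun x => f x :: g x) :=
  comp (g := fun y : α × List α => y.1 :: y.2) (of_enc_eq fun _ => rfl) (hf.pair hg)

theorem enc_list_eq_nil {l : List α} : enc l = .nil ↔ l = [] := by
  cases l <;> simp [enc, Enc.toDatum, Datum.ofList]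

@[fun_prop]
theorem isEmpty {f : δ → List α} (hf : PolyTime f) : PolyTime (fun x => (f x).isEmpty) := by
  refine ite_of_enc hf (const false) (const true) (fun x hx => ?_) (fun x hx => ?_)
  · cases h : f x <;> simp_all [enc_nil]
  · simp [enc_list_eq_nil.1 hx]

@[fun_prop]
theorem tail {f : δ → List α} (hf : PolyTime f) : PolyTime (fun x => (f x).tail) := by
  refine (datum_snd hf).congr_enc fun x => ?_
  cases f x <;> rfl

@[fun_prop]
theorem headD {f : δ → List α} {g : δ → α} (hf : PolyTime f) (hg : PolyTime g) :
    PolyTime (fun x => (f x).headD (g x)) := by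
  refine ite_of_enc hf (datum_fst hf) hg (fun x hx => ?_) (fun x hx => ?_)
  · cases h : f x <;> simp_all [enc_nil]
    rfl
  · simp [enc_list_eq_nil.1 hx]

end PolyTime

/-! ### Folds and list operations in polynomial time -/

namespace PolyTime

variable {α β γ δ σ : Type} [Enc α] [Enc β] [Enc γ] [Enc δ] [Enc σ]

/-- A fold is a loop on triples of context, remaining list and accumulator; the encoding of the
remaining list is itself the loop test. All states reached have length at most `S`, so one bound `K`
serves every round. The predicate `p` allows a loop body that works only for suitable items, as when
the body queries an oracle. -/
theorem runs_foldl {O : Datum → Datum} {A : Datum → Prop} {g : δ → σ → α → σ} {b f : Prog}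
    {c : δ} {S K : ℕ} {p : α → Prop}
    (hb : ∀ (l : List α) (s : σ), len (c, l, s) ≤ S →
      ∃ t, Runs O A b (enc (c, l, s)) (enc l) t ∧ t ≤ K)
    (hf : ∀ (a : α) (l : List α) (s : σ), p a → len (c, a :: l, s) ≤ S →
      ∃ t, Runs O A f (enc (c, a :: l, s)) (enc (c, l, g c s a)) t ∧ t ≤ K)
    (l : List α) (s : σ) (hp : ∀ a ∈ l, p a)
    (hS : ∀ l₁ l₂, l = l₁ ++ l₂ → len (c, l₂, l₁.foldl (g c) s) ≤ S) :
    ∃ t, Runs O A (.loop b f) (enc (c, l, s)) (enc (c, ([] : List α), l.foldl (g c) s)) t ∧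
      t ≤ (l.length + 1) * (2 * K + S + 1) := by
  induction l generalizing s with
  | nil =>
    have h0 : len (c, ([] : List α), s) ≤ S := hS [] [] rfl
    obtain ⟨t, ht, htK⟩ := hb [] s h0
    refine ⟨t + len (c, ([] : List α), s) + 1, by constructor; exact ht, ?_⟩
    simp only [List.length_nil]
    omega
  | cons a l ih =>
    have h0 : len (c, a :: l, s) ≤ S := hS [] (a :: l) rfl
    obtain ⟨t, ht, htK⟩ := hb _ s h0
    obtain ⟨u, hu, huK⟩ := hf _ _ s (hp a (by simp)) h0
    obtain ⟨r, hr, hrK⟩ := ih (g c s a) (fun b hb => hp b (by simp [hb]))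
      fun l₁ l₂ h => hS (a :: l₁) l₂ (by simp [h])
    refine ⟨_, .loop_step ht (by simp [enc_cons]) hu hr, ?_⟩
    change t + u + r + len (c, a :: l, s) + 1 ≤ _
    rw [List.length_cons, add_mul]
    omega

theorem foldl_of_bound {l : δ → List α} {s : δ → σ} {g : δ → σ → α → σ} (hl : PolyTime l)
    (hs : PolyTime s) (hg : PolyTime (fun x : δ × σ × α => g x.1 x.2.1 x.2.2))
    (Q : Polynomial ℕ)
    (hQ : ∀ x l', l' <+: l x → len (l'.foldl (g x) (s x)) ≤ Q.eval (len x)) :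
    PolyTime (fun x => (l x).foldl (g x) (s x)) := by
  have hb : PolyTime (fun y : δ × List α × σ => y.2.1) := by fun_prop
  have hf : PolyTime (fun y : δ × (α × List α) × σ =>
      (y.1, y.2.1.2, (fun x : δ × σ × α => g x.1 x.2.1 x.2.2) (y.1, y.2.2, y.2.1.1))) := by
    fun_prop
  have hi : PolyTime (fun x => (x, l x, s x)) := by fun_prop
  have ho : PolyTime (fun y : δ × List α × σ => y.2.2) := by fun_prop
  obtain ⟨L, hL⟩ := hl.exists_len_le
  obtain ⟨pb, Pb, hpb⟩ := hb
  obtain ⟨pf, Pf, hpf⟩ := hf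
  have hloop : ∃ p P, ∀ O A x, ∃ t, Runs O A p (enc (x, l x, s x))
      (enc (x, ([] : List α), (l x).foldl (g x) (s x))) t ∧
      t ≤ Polynomial.eval (len x) P := by
    -- Context, remaining list, accumulator, and the two pairings of the triple.
    let S : Polynomial ℕ := .X + L + Q + 2
    let K : Polynomial ℕ := Pb.comp S + Pf.comp S
    refine ⟨.loop pb pf, (L + 1) * (2 * K + S + 1), fun O A x => ?_⟩
    obtain ⟨t, ht, htK⟩ := runs_foldl (O := O) (A := A) (g := g) (b := pb) (f := pf) (c := x)
      (S := S.eval (len x)) (K := K.eval (len x)) (p := fun _ => True) (fun l' s' h => by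
        obtain ⟨t, ht, htP⟩ := hpb O A (x, l', s')
        refine ⟨t, ht, htP.trans ?_⟩
        have := eval_le_eval Pb h
        simp only [K, Polynomial.eval_add, Polynomial.eval_comp] at this ⊢
        omega)
      (fun a l' s' _ h => by
        obtain ⟨t, ht, htP⟩ := hpf O A (x, (a, l'), s')
        refine ⟨t, ht, htP.trans ?_⟩
        have := eval_le_eval Pf h
        simp only [K, Polynomial.eval_add, Polynomial.eval_comp] at this ⊢
        exact this.trans (Nat.le_add_left _ _))
      (l x) (s x) (fun _ _ => trivial) (fun l₁ l₂ h => by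
        have h1 := hQ x l₁ ⟨l₂, h.symm⟩
        have h2 : len l₂ ≤ len (l x) := len_sublist (by simp [h])
        have h3 := hL x
        simp [S]
        omega)
    refine ⟨t, ht, htK.trans ?_⟩
    have := (length_le_len (l x)).trans (hL x)
    simp only [Polynomial.eval_add, Polynomial.eval_mul, Polynomial.eval_one,
      Polynomial.eval_ofNat]
    gcongr
  obtain ⟨pl, Pl, hpl⟩ := hloop
  obtain ⟨pi, Pi, hpi⟩ := hi
  obtain ⟨po, Po, hpo⟩ := ho
  refine ⟨.comp po (.comp pl pi), Pi + Pl + Po.comp Pl + 2, fun O A x => ?_⟩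
  obtain ⟨t, ht, htP⟩ := hpi O A x
  obtain ⟨u, hu, huP⟩ := hpl O A x
  obtain ⟨v, hv, hvP⟩ := hpo O A (x, [], (l x).foldl (g x) (s x))
  refine ⟨_, (ht.comp hu).comp hv, ?_⟩
  have := eval_le_eval Po (hu.size_le.trans huP)
  have h2 := hvP.trans this
  simp only [Polynomial.eval_add, Polynomial.eval_comp, Polynomial.eval_ofNat]
  omega

/-- The growth per step is bounded by the input alone, whatever the accumulator is. A
polynomial-time step by itself would not suffice, since repeated squaring of the length is
exponential. -/
theorem foldl {l : δ → List α} {s : δ → σ} {g : δ → σ → α → σ} (hl : PolyTime l)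
    (hs : PolyTime s) (hg : PolyTime (fun x : δ × σ × α => g x.1 x.2.1 x.2.2))
    (Q : Polynomial ℕ) (hQ : ∀ x s a, a ∈ l x → len (g x s a) ≤ len s + Q.eval (len x)) :
    PolyTime (fun x => (l x).foldl (g x) (s x)) := by
  obtain ⟨L, hL⟩ := hl.exists_len_le
  obtain ⟨S, hS⟩ := hs.exists_len_le
  refine foldl_of_bound hl hs hg (S + L * Q) fun x l' h => ?_
  have key : ∀ (l' : List α) (s : σ), (∀ a ∈ l', a ∈ l x) →
      len (l'.foldl (g x) s) ≤ len s + l'.length * Q.eval (len x) := by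
    intro l'
    induction l' with
    | nil => simp
    | cons a l' ih =>
      intro s hm
      have h1 := ih (g x s a) fun b hb => hm b (by simp [hb])
      have h2 := hQ x s a (hm a (by simp))
      simp only [List.foldl_cons, List.length_cons, add_mul]
      omega
  have h1 := key l' (s x) fun a ha => h.subset ha
  have h2 := hS x
  have h3 : l'.length ≤ L.eval (len x) :=
    h.length_le.trans ((length_le_len _).trans (hL x))
  have h4 := Nat.mul_le_mul_right (Q.eval (len x)) h3
  simp only [Polynomial.eval_add, Polynomial.eval_mul]
  omega

theorem foldl_of_le {l : δ → List α} {s : δ → σ} {g : δ → σ → α → σ} (hl : PolyTime l)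
    (hs : PolyTime s) (hg : PolyTime (fun x : δ × σ × α => g x.1 x.2.1 x.2.2)) (k : ℕ)
    (hQ : ∀ x s a, len (g x s a) ≤ len s + k) :
    PolyTime (fun x => (l x).foldl (g x) (s x)) :=
  foldl hl hs hg (Polynomial.C k) fun x s a _ => by simpa using hQ x s a

@[fun_prop]
theorem reverse {l : δ → List α} (hl : PolyTime l) : PolyTime (fun x => (l x).reverse) := by
  refine of_eq (foldl (g := fun _ s a => a :: s) hl (const []) (by fun_prop)
    (hl.exists_len_le.choose + 1) fun x s a ha => ?_) fun x => (?_ : _ = _)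
  · have h1 := len_mem ha
    have h2 := hl.exists_len_le.choose_spec x
    simp
    omega
  · simp

@[fun_prop]
theorem map {l : δ → List α} {f : δ → α → β} (hl : PolyTime l)
    (hf : PolyTime (fun x : δ × α => f x.1 x.2)) : PolyTime (fun x => (l x).map (f x)) := by
  obtain ⟨L, hL⟩ := hl.exists_len_le
  obtain ⟨F, hF⟩ := hf.exists_len_le
  have hg : PolyTime (fun x : δ × List β × α => f x.1 x.2.2 :: x.2.1) :=
    cons (comp hf (g := fun x : δ × α => f x.1 x.2) (f := fun x : δ × List β × α => (x.1, x.2.2))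
      (by fun_prop)) (by fun_prop)
  have := foldl (g := fun x s a => f x a :: s) hl (const []) hg (F.comp (.X + L + 1) + 1)
    fun x s a ha => by
      have h1 := len_mem ha
      have h2 := hL x
      have h3 := hF (x, a)
      have h4 : F.eval (len (x, a)) ≤ F.eval (len x + L.eval (len x) + 1) :=
        eval_le_eval F (by simp; omega)
      simp at h3 ⊢
      simp at h4
      omega
  refine this.reverse.of_eq fun x => ?_
  simp

@[fun_prop]
theorem filter {l : δ → List α} {p : δ → α → Bool} (hl : PolyTime l)
    (hp : PolyTime (fun x : δ × α => p x.1 x.2)) : PolyTime (fun x => (l x).filter (p x)) := by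
  have hb : PolyTime (fun x : δ × List α × α => p x.1 x.2.2) :=
    comp hp (g := fun x : δ × α => p x.1 x.2) (f := fun x : δ × List α × α => (x.1, x.2.2))
      (by fun_prop)
  have := foldl (g := fun x s a => if p x a then a :: s else s) hl (const [])
    (ite_bool hb (by fun_prop) (by fun_prop)) (hl.exists_len_le.choose + 1) fun x s a ha => by
      have h1 := len_mem ha
      have h2 := hl.exists_len_le.choose_spec x
      split
      · simp
        omega
      · simp
  refine this.reverse.of_eq fun x => ?_
  have : ∀ (m s : List α), m.foldl (fun s a => if p x a then a :: s else s) s =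
      (m.filter (p x)).reverse ++ s := by
    intro m
    induction m with
    | nil => simp
    | cons a m ih => intro s; by_cases h : p x a <;> simp [h, ih]
  simp [this]

@[fun_prop]
theorem any {l : δ → List α} {p : δ → α → Bool} (hl : PolyTime l)
    (hp : PolyTime (fun x : δ × α => p x.1 x.2)) : PolyTime (fun x => (l x).any (p x)) := by
  refine (filter hl hp).isEmpty.not.of_eq fun x => ?_
  rw [Bool.eq_iff_iff]
  simp

@[fun_prop]
theorem append {l m : δ → List α} (hl : PolyTime l) (hm : PolyTime m) :
    PolyTime (fun x => l x ++ m x) := by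
  have := foldl (g := fun _ s a => a :: s) hl.reverse hm (by fun_prop)
    (hl.reverse.exists_len_le.choose + 1) fun x s a ha => by
      have h1 := len_mem ha
      have h2 := hl.reverse.exists_len_le.choose_spec x
      simp
      omega
  refine this.of_eq fun x => ?_
  simp

@[fun_prop]
theorem flatMap {l : δ → List α} {f : δ → α → List β} (hl : PolyTime l)
    (hf : PolyTime (fun x : δ × α => f x.1 x.2)) : PolyTime (fun x => (l x).flatMap (f x)) := by
  obtain ⟨L, hL⟩ := hl.exists_len_le
  obtain ⟨F, hF⟩ := hf.exists_len_le
  have hg : PolyTime (fun x : δ × List β × α => x.2.1 ++ f x.1 x.2.2) :=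
    append (by fun_prop) (comp hf (g := fun x : δ × α => f x.1 x.2)
      (f := fun x : δ × List β × α => (x.1, x.2.2)) (by fun_prop))
  have := foldl (g := fun x s a => s ++ f x a) hl (const []) hg (F.comp (.X + L + 1))
    fun x s a ha => by
      have h1 := len_mem ha
      have h2 := hL x
      have h3 := hF (x, a)
      have h4 : F.eval (len (x, a)) ≤ F.eval (len x + L.eval (len x) + 1) :=
        eval_le_eval F (by simp; omega)
      have h5 := len_append s (f x a)
      simp at h3 h4 ⊢
      omega
  refine this.of_eq fun x => ?_
  have : ∀ (m : List α) (s : List β), m.foldl (fun s a => s ++ f x a) s = s ++ m.flatMap (f x) := by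
    intro m
    induction m with
    | nil => simp
    | cons a m ih => intro s; simp [ih]
  simp [this]

/-! ### Arithmetic -/

/-- A unary number and a list of that many units are the same word, so recursion on numbers becomes
a fold. -/
theorem replicate_unit {f : δ → ℕ} (hf : PolyTime f) :
    PolyTime (fun x => List.replicate (f x) ()) := by
  refine hf.congr_enc fun x => ?_
  induction f x with
  | zero => rfl
  | succ n ih => rw [List.replicate_succ, enc_cons, ih]; rfl

@[fun_prop]
theorem succ {f : δ → ℕ} (hf : PolyTime f) : PolyTime (fun x => f x + 1) :=
  (pair (const ()) hf).congr_enc fun _ => rfl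

@[fun_prop]
theorem length {l : δ → List α} (hl : PolyTime l) : PolyTime (fun x => (l x).length) := by
  have := foldl_of_le (g := fun _ (s : ℕ) (_ : α) => s + 1) hl (const 0) (by fun_prop) 2
    fun x s a => by simp; omega
  refine this.of_eq fun x => ?_
  simp

@[fun_prop]
theorem pred {f : δ → ℕ} (hf : PolyTime f) : PolyTime (fun x => f x - 1) := by
  refine (datum_snd hf).congr_enc fun x => ?_
  cases f x <;> rfl

@[fun_prop]
theorem sub {f g : δ → ℕ} (hf : PolyTime f) (hg : PolyTime g) : PolyTime (fun x => f x - g x) := by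
  have := foldl_of_le (g := fun _ (s : ℕ) (_ : Unit) => s - 1) hg.replicate_unit hf (by fun_prop) 0
    fun x s a => by simp
  refine this.of_eq fun x => ?_
  induction g x with
  | zero => simp
  | succ n ih => simp [List.replicate_succ', ← ih]; omega

@[fun_prop]
theorem add {f g : δ → ℕ} (hf : PolyTime f) (hg : PolyTime g) : PolyTime (fun x => f x + g x) :=
  (hf.replicate_unit.append hg.replicate_unit).length.of_eq fun x => by simp

@[fun_prop]
theorem mul {f g : δ → ℕ} (hf : PolyTime f) (hg : PolyTime g) : PolyTime (fun x => f x * g x) := by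
  have h : PolyTime (fun x => (List.replicate (f x) ()).flatMap fun _ => List.replicate (g x) ()) :=
    flatMap hf.replicate_unit
      (f := fun x _ => List.replicate (g x) ()) (replicate_unit (hg.comp (by fun_prop)))
  exact h.length.of_eq fun x => by simp

@[fun_prop]
theorem lt {f g : δ → ℕ} (hf : PolyTime f) (hg : PolyTime g) :
    PolyTime (fun x => decide (f x < g x)) := by
  refine ((sub hg hf).replicate_unit.isEmpty.not).of_eq fun x => ?_
  rw [Bool.eq_iff_iff]
  simp
  omega

@[fun_prop]
theorem le {f g : δ → ℕ} (hf : PolyTime f) (hg : PolyTime g) :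
    PolyTime (fun x => decide (f x ≤ g x)) := by
  refine (lt hg hf).not.of_eq fun x => ?_
  rw [Bool.eq_iff_iff]
  simp

@[fun_prop]
theorem eq {f g : δ → ℕ} (hf : PolyTime f) (hg : PolyTime g) :
    PolyTime (fun x => decide (f x = g x)) := by
  refine ((le hf hg).and (le hg hf)).of_eq fun x => ?_
  rw [Bool.eq_iff_iff]
  simp
  omega

@[fun_prop]
theorem mem {f : δ → ℕ} {l : δ → List ℕ} (hf : PolyTime f) (hl : PolyTime l) :
    PolyTime (fun x => decide (f x ∈ l x)) := by
  have : PolyTime (fun x => (l x).any fun a => decide (a = f x)) := by fun_prop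
  refine this.of_eq fun x => ?_
  rw [Bool.eq_iff_iff]
  simp

@[fun_prop]
theorem getD {l : δ → List α} {f : δ → ℕ} {d : δ → α} (hl : PolyTime l) (hf : PolyTime f)
    (hd : PolyTime d) : PolyTime (fun x => (l x).getD (f x) (d x)) := by
  have := foldl_of_le (g := fun _ (s : List α) (_ : Unit) => s.tail) hf.replicate_unit hl
    (by fun_prop) 0 fun x s a => len_sublist (List.tail_sublist s)
  refine (this.headD hd).of_eq fun x => ?_
  have : ∀ (n : ℕ) (m : List α),
      ((List.replicate n ()).foldl (fun (s : List α) _ => s.tail) m).headD (d x) =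
        m.getD n (d x) := by
    intro n
    induction n with
    | zero => intro m; cases m <;> simp
    | succ n ih => intro m; rw [List.replicate_succ, List.foldl_cons, ih]; cases m <;> simp
  exact (this _ _).symm

@[fun_prop]
theorem range {f : δ → ℕ} (hf : PolyTime f) : PolyTime (fun x => List.range (f x)) := by
  obtain ⟨F, hF⟩ := hf.exists_len_le
  have key : ∀ n : ℕ, (List.replicate n ()).foldl
      (fun (s : List ℕ) (_ : Unit) => s ++ [s.length]) [] = List.range n := by
    intro n
    induction n with
    | zero => rfl
    | succ n ih => rw [List.replicate_succ', List.foldl_append, ih]; simp [List.range_succ]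
  -- The appended entry grows with the accumulator, so no uniform bound per step exists; the
  -- intermediate lists are bounded directly.
  have := foldl_of_bound (g := fun _ (s : List ℕ) (_ : Unit) => s ++ [s.length])
    hf.replicate_unit (const []) (by fun_prop) (1 + F * (F + 1)) fun x l' h => by
      obtain ⟨n, rfl⟩ : ∃ n, l' = List.replicate n () := ⟨_, List.eq_replicate_length.2 (by simp)⟩
      have h1 := h.length_le
      have h2 := hF x
      simp only [List.length_replicate, len_nat] at h1 h2
      rw [key]
      have h3 := len_le_of_forall (l := List.range n) (k := F.eval (len x)) fun a ha => by
        simp at ha ⊢; omega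
      refine h3.trans ?_
      simp
      omega
  exact this.of_eq fun x => (key _).symm

end PolyTime

/-! ## The functions computed by the kernel -/

/-- The non-isolated vertices among `0, …, n - 1`, in increasing order. -/
def touched (n : ℕ) (E : List (ℕ × ℕ)) : List ℕ :=
  (List.range n).filter fun v => E.any fun e => decide (v = e.1) || decide (v = e.2)

/-- The edges with both ends in `Y`. -/
def spanned (E : List (ℕ × ℕ)) (Y : List ℕ) : List (ℕ × ℕ) :=
  E.filter fun e => decide (e.1 ∈ Y) && decide (e.2 ∈ Y)

/-- The number of elements of `Y` below `v`. -/
def rank (Y : List ℕ) (v : ℕ) : ℕ := (Y.filter fun u => decide (u < v)).length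

/-- The elements of `vs` that lie in `A`. -/
def restrict (vs A : List ℕ) : List ℕ := vs.filter fun v => decide (v ∈ A)

/-- Whether the node `t` is the root `0` or occurs in the order built so far. -/
def reached (ord : List (ℕ × ℕ)) (t : ℕ) : Bool :=
  decide (t = 0) || ord.any fun e => decide (e.1 = t)

/-- Extend an order of nodes, listed with their parents, along an edge of the tree. -/
def attach (ord : List (ℕ × ℕ)) (e : ℕ × ℕ) : List (ℕ × ℕ) :=
  if reached ord e.1 then (if reached ord e.2 then ord else (e.2, e.1) :: ord)
  else if reached ord e.2 then (e.1, e.2) :: ord else ord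

/-- One pass reaches at least all neighbours of the nodes reached before it, so as many passes as
there are nodes reach the whole tree. -/
def sweep (links ord : List (ℕ × ℕ)) : List (ℕ × ℕ) := links.foldl attach ord

/-- The nodes other than the root `0` with their parents, the last ones first. -/
def treeOrder (bags : List (List ℕ)) (links : List (ℕ × ℕ)) : List (ℕ × ℕ) :=
  bags.foldl (fun ord _ => sweep links ord) []

/-- The set of vertices stored at the node `t`, which is its bag as long as nothing is stored. -/
def look (vs : List ℕ) (bags : List (List ℕ)) (acc : List (ℕ × List ℕ)) (t : ℕ) : List ℕ :=
  ((acc.filter fun e => decide (e.1 = t)).map Prod.snd).headD (restrict vs (bags.getD t []))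

/-- Move the set stored at a node to its parent; if the result has at least `M` elements, cut it
off, except for the bag of the parent. -/
def carveStep (vs : List ℕ) (bags : List (List ℕ)) (M : ℕ)
    (s : List (ℕ × List ℕ) × List (List ℕ)) (e : ℕ × ℕ) : List (ℕ × List ℕ) × List (List ℕ) :=
  if M ≤ (restrict vs (look vs bags s.1 e.1 ++ look vs bags s.1 e.2)).length then
    ((e.2, restrict vs (bags.getD e.2 [])) :: s.1,
      restrict vs (look vs bags s.1 e.1 ++ look vs bags s.1 e.2) :: s.2)
  else ((e.2, restrict vs (look vs bags s.1 e.1 ++ look vs bags s.1 e.2)) :: s.1, s.2)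

/-- Finish with the set stored at the root. -/
def carveEnd (vs : List ℕ) (bags : List (List ℕ)) (s : List (ℕ × List ℕ) × List (List ℕ)) :
    List (List ℕ) :=
  look vs bags s.1 0 :: s.2

/-- The pieces into which the graph is split. -/
def carve (vs : List ℕ) (bags : List (List ℕ)) (M : ℕ) (ord : List (ℕ × ℕ)) : List (List ℕ) :=
  carveEnd vs bags (ord.foldl (carveStep vs bags M) ([], []))

/-- The part of a cover that is still needed: every set is replaced by the list of the ends of the
edges that it is the first one to cover. -/
def shrinkStep (s : List (ℕ × ℕ) × List (List ℕ)) (C : List ℕ) : List (ℕ × ℕ) × List (List ℕ) :=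
  (s.1.filter fun e => !(decide (e.1 ∈ C) && decide (e.2 ∈ C)),
    if (spanned s.1 C).isEmpty then s.2 else (spanned s.1 C).flatMap (fun e => [e.1, e.2]) :: s.2)

def shrink (E : List (ℕ × ℕ)) (L : List (List ℕ)) : List (List ℕ) :=
  (L.foldl shrinkStep (E, [])).2

/-- Graphs with a decomposition, in the form that programs work on. -/
abbrev RawGraph : Type := ℕ × List (List ℕ) × List (List ℕ) × List (List ℕ)

/-- The subgraph induced by `Y`, with all vertices in one bag. -/
def induced (E : List (ℕ × ℕ)) (Y : List ℕ) : RawGraph :=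
  (Y.length, (spanned E Y).map (fun e => [rank Y e.1, rank Y e.2]), [List.range Y.length], [])

def toPair (l : List ℕ) : ℕ × ℕ := (l.headD 0, l.tail.headD 0)

/-- The number of vertices from which on a piece is cut off. -/
def threshold (a ℓ : ℕ) : ℕ := (2 * a + 1) * ((ℓ + 1) * (ℓ + 1) * (ℓ + 1))

/-- The work before the queries: the edges, the pieces with the queries, and no answers yet. -/
def prepare (a : ℕ) (x : RawGraph × ℕ) :
    List (ℕ × ℕ) × List (List ℕ × RawGraph × ℕ) × List (List ℕ × List (List ℕ)) :=
  (x.1.2.1.map toPair,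
    (carve (touched x.1.1 (x.1.2.1.map toPair)) x.1.2.2.1 (threshold a x.2)
      (treeOrder x.1.2.2.1 (x.1.2.2.2.map toPair))).map
      (fun Y => (Y, induced (x.1.2.1.map toPair) Y, Y.length - 1)), [])

/-- The work after the queries: combine the answers. -/
def finish (x : List (ℕ × ℕ) × List (List ℕ × RawGraph × ℕ) ×
    List (List ℕ × List (List ℕ))) : List (List ℕ) :=
  shrink x.1 (x.2.2.flatMap fun it => it.2.map fun C => C.map fun i => it.1.getD i 0)

/-! ### Length bounds for the functions of the kernel -/

theorem len_filter_not_add {α : Type} [Enc α] (p : α → Bool) (l : List α) :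
    len (l.filter fun a => !p a) + len (l.filter p) = len l + 1 := by
  induction l with
  | nil => simp
  | cons a l ih => cases h : p a <;> simp [h] <;> omega

theorem length_filter_not_add {α : Type} (p : α → Bool) (l : List α) :
    (l.filter fun a => !p a).length + (l.filter p).length = l.length := by
  induction l with
  | nil => simp
  | cons a l ih => cases h : p a <;> simp [h] <;> omega

theorem len_flatMap_ends (l : List (ℕ × ℕ)) : len (l.flatMap fun e => [e.1, e.2]) = len l := by
  induction l with
  | nil => simp
  | cons e l ih =>
    obtain ⟨u, v⟩ := e
    simp at ih ⊢
    omega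

/-- A potential argument: turning the newly covered edges into a set of their ends costs two extra
nodes, and this is paid by the term 2 for each edge removed. The initial potential is essentially
the length of `ends E`. -/
theorem len_shrinkStep (s : List (ℕ × ℕ) × List (List ℕ)) (C : List ℕ) :
    len (shrinkStep s C).1 + 2 * (shrinkStep s C).1.length + len (shrinkStep s C).2 ≤
      len s.1 + 2 * s.1.length + len s.2 := by
  have h1 := len_filter_not_add (fun e : ℕ × ℕ => decide (e.1 ∈ C) && decide (e.2 ∈ C)) s.1
  have h2 := length_filter_not_add (fun e : ℕ × ℕ => decide (e.1 ∈ C) && decide (e.2 ∈ C)) s.1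
  have h3 := len_flatMap_ends (spanned s.1 C)
  have h4 := one_le_len (spanned s.1 C)
  unfold shrinkStep
  split
  · simp only [spanned] at *
    omega
  · rename_i hne
    have : 1 ≤ (spanned s.1 C).length := by
      rw [Nat.one_le_iff_ne_zero]
      simpa using hne
    simp only [len_cons, spanned] at *
    omega

theorem len_foldl_shrinkStep (L : List (List ℕ)) (s : List (ℕ × ℕ) × List (List ℕ)) :
    len (L.foldl shrinkStep s).1 + len (L.foldl shrinkStep s).2 ≤
      len s.1 + 2 * s.1.length + len s.2 := by
  induction L generalizing s with
  | nil =>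
    simp only [List.foldl_nil]
    omega
  | cons C L ih => exact (ih _).trans (len_shrinkStep s C)

theorem len_shrink_le (E : List (ℕ × ℕ)) (L : List (List ℕ)) :
    len (shrink E L) ≤ len E + 2 * E.length := by
  have h1 := len_foldl_shrinkStep L (E, [])
  have h2 := one_le_len (L.foldl shrinkStep (E, [])).1
  simp only [len_nil] at h1
  unfold shrink
  omega

theorem len_attach (ord : List (ℕ × ℕ)) (e : ℕ × ℕ) : len (attach ord e) ≤ len ord + len e + 1 := by
  obtain ⟨u, v⟩ := e
  unfold attach
  split_ifs <;> simp <;> omega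

theorem len_sweep (links ord : List (ℕ × ℕ)) : len (sweep links ord) ≤ len ord + len links := by
  unfold sweep
  induction links generalizing ord with
  | nil => simp
  | cons e l ih =>
    have h1 := ih (attach ord e)
    have h2 := len_attach ord e
    simp only [List.foldl_cons, len_cons]
    omega

theorem len_restrict (vs A : List ℕ) : len (restrict vs A) ≤ len vs :=
  len_sublist List.filter_sublist

/-- Since `restrict vs` keeps every stored set a sublist of `vs`, the growth does not depend on what
was stored before. -/
theorem len_carveStep (vs : List ℕ) (bags : List (List ℕ)) (M : ℕ)
    (s : List (ℕ × List ℕ) × List (List ℕ)) (e : ℕ × ℕ) :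
    len (carveStep vs bags M s e) ≤ len s + (len e + 2 * len vs + 3) := by
  obtain ⟨acc, out⟩ := s
  obtain ⟨t, p⟩ := e
  unfold carveStep
  have h1 := len_restrict vs (look vs bags acc t ++ look vs bags acc p)
  have h2 := len_restrict vs (bags.getD p [])
  split <;>
  · simp only [len_pair, len_cons]
    omega

/-! ### The functions of the kernel run in polynomial time -/

namespace PolyTime

variable {δ : Type} [Enc δ]

@[fun_prop]
theorem touched {n : δ → ℕ} {E : δ → List (ℕ × ℕ)} (hn : PolyTime n) (hE : PolyTime E) :
    PolyTime (fun x => touched (n x) (E x)) := by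
  unfold TuringKernel.touched
  fun_prop

@[fun_prop]
theorem spanned {E : δ → List (ℕ × ℕ)} {Y : δ → List ℕ} (hE : PolyTime E) (hY : PolyTime Y) :
    PolyTime (fun x => spanned (E x) (Y x)) := by
  unfold TuringKernel.spanned
  fun_prop

@[fun_prop]
theorem rank {Y : δ → List ℕ} {v : δ → ℕ} (hY : PolyTime Y) (hv : PolyTime v) :
    PolyTime (fun x => rank (Y x) (v x)) := by
  unfold TuringKernel.rank
  fun_prop

@[fun_prop]
theorem restrict {Y Z : δ → List ℕ} (hY : PolyTime Y) (hZ : PolyTime Z) :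
    PolyTime (fun x => restrict (Y x) (Z x)) := by
  unfold TuringKernel.restrict
  fun_prop

@[fun_prop]
theorem reached {o : δ → List (ℕ × ℕ)} {t : δ → ℕ} (ho : PolyTime o) (ht : PolyTime t) :
    PolyTime (fun x => reached (o x) (t x)) := by
  unfold TuringKernel.reached
  fun_prop

@[fun_prop]
theorem attach {o : δ → List (ℕ × ℕ)} {e : δ → ℕ × ℕ} (ho : PolyTime o) (he : PolyTime e) :
    PolyTime (fun x => attach (o x) (e x)) := by
  unfold TuringKernel.attach
  exact ite_bool (by fun_prop) (ite_bool (by fun_prop) (by fun_prop) (by fun_prop))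
    (ite_bool (by fun_prop) (by fun_prop) (by fun_prop))

@[fun_prop]
theorem sweep {l o : δ → List (ℕ × ℕ)} (hl : PolyTime l) (ho : PolyTime o) :
    PolyTime (fun x => sweep (l x) (o x)) := by
  obtain ⟨Q, hQ⟩ := hl.exists_len_le
  refine foldl (g := fun _ => TuringKernel.attach) hl ho (by fun_prop) (Q + 1) fun x s e he => ?_
  have h1 := len_attach s e
  have h2 := len_mem he
  have h3 := hQ x
  simp
  omega

@[fun_prop]
theorem treeOrder {b : δ → List (List ℕ)} {l : δ → List (ℕ × ℕ)} (hb : PolyTime b)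
    (hl : PolyTime l) : PolyTime (fun x => treeOrder (b x) (l x)) := by
  obtain ⟨Q, hQ⟩ := hl.exists_len_le
  refine foldl (g := fun x ord _ => TuringKernel.sweep (l x) ord) hb (const []) (by fun_prop) Q
    fun x s e he => ?_
  have h1 := len_sweep (l x) s
  have h3 := hQ x
  omega

@[fun_prop]
theorem look {vs : δ → List ℕ} {bags : δ → List (List ℕ)} {acc : δ → List (ℕ × List ℕ)}
    {t : δ → ℕ} (hv : PolyTime vs) (hb : PolyTime bags) (ha : PolyTime acc) (ht : PolyTime t) :
    PolyTime (fun x => look (vs x) (bags x) (acc x) (t x)) := by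
  unfold TuringKernel.look
  fun_prop

@[fun_prop]
theorem carveStep {vs : δ → List ℕ} {bags : δ → List (List ℕ)} {M : δ → ℕ}
    {s : δ → List (ℕ × List ℕ) × List (List ℕ)} {e : δ → ℕ × ℕ} (hv : PolyTime vs)
    (hb : PolyTime bags) (hM : PolyTime M) (hs : PolyTime s) (he : PolyTime e) :
    PolyTime (fun x => carveStep (vs x) (bags x) (M x) (s x) (e x)) := by
  unfold TuringKernel.carveStep
  fun_prop

@[fun_prop]
theorem carve {vs : δ → List ℕ} {bags : δ → List (List ℕ)} {M : δ → ℕ}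
    {ord : δ → List (ℕ × ℕ)} (hv : PolyTime vs)
    (hb : PolyTime bags) (hM : PolyTime M) (ho : PolyTime ord) :
    PolyTime (fun x => carve (vs x) (bags x) (M x) (ord x)) := by
  obtain ⟨V, hV⟩ := hv.exists_len_le
  obtain ⟨Q, hQ⟩ := ho.exists_len_le
  have := foldl (g := fun x => TuringKernel.carveStep (vs x) (bags x) (M x)) ho (const ([], []))
    (by fun_prop) (Q + 2 * V + 3) fun x s e he => by
      have h1 := len_carveStep (vs x) (bags x) (M x) s e
      have h2 := len_mem he
      have h3 := hQ x
      have h4 := hV x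
      simp
      omega
  unfold TuringKernel.carve carveEnd
  fun_prop

@[fun_prop]
theorem shrinkStep {s : δ → List (ℕ × ℕ) × List (List ℕ)} {C : δ → List ℕ} (hs : PolyTime s)
    (hC : PolyTime C) : PolyTime (fun x => shrinkStep (s x) (C x)) := by
  unfold TuringKernel.shrinkStep
  exact pair (by fun_prop) (ite_bool (by fun_prop) (by fun_prop) (by fun_prop))

@[fun_prop]
theorem shrink {E : δ → List (ℕ × ℕ)} {L : δ → List (List ℕ)} (hE : PolyTime E)
    (hL : PolyTime L) : PolyTime (fun x => shrink (E x) (L x)) := by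
  obtain ⟨Q, hQ⟩ := hE.exists_len_le
  -- The new set is built from the remaining edges in the state, so the potential bounds the states
  -- reached from `(E x, [])`.
  have := foldl_of_bound (g := fun _ => TuringKernel.shrinkStep) hL (hE.pair (const []))
    (by fun_prop) (3 * Q + 2) fun x l' _ => by
      have h1 := len_foldl_shrinkStep l' (E x, [])
      have h2 := hQ x
      have h3 := length_le_len (E x)
      change len (l'.foldl TuringKernel.shrinkStep (E x, [])).1 +
        len (l'.foldl TuringKernel.shrinkStep (E x, [])).2 + 1 ≤ _
      simp at *
      omega
  unfold TuringKernel.shrink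
  fun_prop

@[fun_prop]
theorem induced {E : δ → List (ℕ × ℕ)} {Y : δ → List ℕ} (hE : PolyTime E) (hY : PolyTime Y) :
    PolyTime (fun x => induced (E x) (Y x)) := by
  unfold TuringKernel.induced
  fun_prop

@[fun_prop]
theorem toPair {l : δ → List ℕ} (hl : PolyTime l) : PolyTime (fun x => toPair (l x)) := by
  unfold TuringKernel.toPair
  fun_prop

@[fun_prop]
theorem threshold {l : δ → ℕ} (a : ℕ) (hl : PolyTime l) :
    PolyTime (fun x => threshold a (l x)) := by
  unfold TuringKernel.threshold
  fun_prop

theorem prepare (a : ℕ) : PolyTime (prepare a) := by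
  unfold TuringKernel.prepare
  fun_prop

theorem finish : PolyTime finish := by
  unfold TuringKernel.finish
  fun_prop

end PolyTime

/-! ## Covers as lists, and their minimum size -/

/-- `L` lists cliques of the graph with edge list `E` that cover all edges. -/
structure ListCover (E : List (ℕ × ℕ)) (L : List (List ℕ)) : Prop where
  clique : ∀ C ∈ L, ∀ u ∈ C, ∀ v ∈ C, u < v → (u, v) ∈ E
  cover : ∀ e ∈ E, ∃ C ∈ L, e.1 ∈ C ∧ e.2 ∈ C

theorem mem_spanned {E : List (ℕ × ℕ)} {Y : List ℕ} {e : ℕ × ℕ} :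
    e ∈ spanned E Y ↔ e ∈ E ∧ e.1 ∈ Y ∧ e.2 ∈ Y := by
  simp [spanned]

/-- Each new set consists of ends of still uncovered edges inside one set of `L`. Hence it remains a
clique, contains no vertices other than ends of edges, and no covered edge is lost. -/
theorem foldl_shrinkStep_spec (L : List (List ℕ)) (r : List (ℕ × ℕ)) (o : List (List ℕ)) :
    (L.foldl shrinkStep (r, o)).2.length ≤ o.length + L.length ∧
    (∀ C ∈ o, C ∈ (L.foldl shrinkStep (r, o)).2) ∧
    (∀ C ∈ (L.foldl shrinkStep (r, o)).2, C ∈ o ∨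
      (∃ D ∈ L, ∀ v ∈ C, v ∈ D) ∧ ∀ v ∈ C, ∃ e ∈ r, v = e.1 ∨ v = e.2) ∧
    ∀ e ∈ r, (∃ C ∈ L, e.1 ∈ C ∧ e.2 ∈ C) →
      ∃ C ∈ (L.foldl shrinkStep (r, o)).2, e.1 ∈ C ∧ e.2 ∈ C := by
  induction L generalizing r o with
  | nil => simp
  | cons D L ih =>
    rw [List.foldl_cons]
    obtain ⟨h1, h2, h3, h4⟩ := ih (shrinkStep (r, o) D).1 (shrinkStep (r, o) D).2
    rw [Prod.mk.eta] at h1 h2 h3 h4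
    have hlen : (shrinkStep (r, o) D).2.length ≤ o.length + 1 := by
      unfold shrinkStep
      dsimp only
      split <;> simp
    have hsub : ∀ C ∈ o, C ∈ (shrinkStep (r, o) D).2 := by
      intro C hC
      unfold shrinkStep
      dsimp only
      split <;> simp [hC]
    have hnew : ∀ C ∈ (shrinkStep (r, o) D).2, C ∈ o ∨
        (∀ v ∈ C, v ∈ D) ∧ ∀ v ∈ C, ∃ e ∈ r, v = e.1 ∨ v = e.2 := by
      intro C hC
      unfold shrinkStep at hC
      dsimp only at hC
      split at hC
      · exact .inl hC
      · rcases List.mem_cons.1 hC with rfl | hC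
        · right
          constructor <;>
          · intro v hv
            obtain ⟨e, he, hv⟩ := List.mem_flatMap.1 hv
            obtain ⟨he, hu, hw⟩ := mem_spanned.1 he
            simp only [List.mem_cons, List.not_mem_nil, or_false] at hv
            first
            | exact ⟨e, he, hv⟩
            | rcases hv with rfl | rfl <;> assumption
        · exact .inl hC
    refine ⟨by simp only [List.length_cons]; omega, fun C hC => h2 C (hsub C hC), fun C hC => ?_, fun e he hc => ?_⟩
    · rcases h3 C hC with h | ⟨⟨D', hD', h⟩, h'⟩
      · rcases hnew C h with h | ⟨h, h'⟩
        · exact .inl h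
        · exact .inr ⟨⟨D, by simp, h⟩, h'⟩
      · refine .inr ⟨⟨D', by simp [hD'], h⟩, fun v hv => ?_⟩
        obtain ⟨e, he, hve⟩ := h' v hv
        exact ⟨e, (List.mem_filter.1 he).1, hve⟩
    · by_cases hD : e.1 ∈ D ∧ e.2 ∈ D
      · have hmem : e ∈ spanned r D := mem_spanned.2 ⟨he, hD⟩
        refine ⟨(spanned r D).flatMap fun e => [e.1, e.2], h2 _ ?_, ?_, ?_⟩
        · unfold shrinkStep
          dsimp only
          rw [if_neg]
          · simp
          · simpa [List.isEmpty_iff] using List.ne_nil_of_mem hmem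
        · exact List.mem_flatMap.2 ⟨e, hmem, by simp⟩
        · exact List.mem_flatMap.2 ⟨e, hmem, by simp⟩
      · refine h4 e (List.mem_filter.2 ⟨he, by simpa [imp_iff_not_or] using hD⟩) ?_
        obtain ⟨C, hC, h⟩ := hc
        rcases List.mem_cons.1 hC with rfl | hC
        · exact absurd h hD
        · exact ⟨C, hC, h⟩

theorem length_shrink_le (E : List (ℕ × ℕ)) (L : List (List ℕ)) :
    (shrink E L).length ≤ L.length := by
  simpa [shrink] using (foldl_shrinkStep_spec L E []).1

theorem ListCover.shrink {E : List (ℕ × ℕ)} {L : List (List ℕ)} (h : ListCover E L) :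
    ListCover E (shrink E L) := by
  obtain ⟨-, -, h3, h4⟩ := foldl_shrinkStep_spec L E []
  refine ⟨fun C hC u hu v hv huv => ?_, fun e he => h4 e he (h.cover e he)⟩
  rcases h3 C hC with h' | ⟨⟨D, hD, hCD⟩, -⟩
  · simp at h'
  · exact h.clique D hD u (hCD u hu) v (hCD v hv) huv

theorem mem_shrink {E : List (ℕ × ℕ)} {L : List (List ℕ)} {C : List ℕ} {v : ℕ}
    (hC : C ∈ shrink E L) (hv : v ∈ C) : ∃ e ∈ E, v = e.1 ∨ v = e.2 := by
  rcases (foldl_shrinkStep_spec L E []).2.2.1 C hC with h' | ⟨-, h⟩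
  · simp at h'
  · exact h v hv

/-- The minimum number of cliques that cover all edges. -/
noncomputable def coverNumber (E : List (ℕ × ℕ)) : ℕ :=
  sInf {k | ∃ L, ListCover E L ∧ L.length = k}

theorem coverNumber_le {E : List (ℕ × ℕ)} {L : List (List ℕ)} (h : ListCover E L) :
    coverNumber E ≤ L.length :=
  Nat.sInf_le ⟨L, h, rfl⟩

theorem listCover_edges {E : List (ℕ × ℕ)} (hE : ∀ e ∈ E, e.1 < e.2) :
    ListCover E (E.map fun e => [e.1, e.2]) := by
  refine ⟨fun C hC u hu v hv huv => ?_, fun e he => ⟨_, List.mem_map_of_mem he, by simp⟩⟩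
  obtain ⟨e, he, rfl⟩ := List.mem_map.1 hC
  have := hE e he
  simp only [List.mem_cons, List.not_mem_nil, or_false] at hu hv
  rcases hu with rfl | rfl <;> rcases hv with rfl | rfl
  · omega
  · exact he
  · omega
  · omega

theorem exists_listCover {E : List (ℕ × ℕ)} (hE : ∀ e ∈ E, e.1 < e.2) :
    ∃ L, ListCover E L ∧ L.length = coverNumber E :=
  Nat.sInf_mem (s := {k | ∃ L, ListCover E L ∧ L.length = k}) ⟨_, _, listCover_edges hE, rfl⟩

/-! ## Encodings of instances -/

theorem enc_nat_injective : Function.Injective (enc : ℕ → Datum) := fun m n h => by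
  have : len m = len n := congrArg Datum.size h
  simpa using this

theorem enc_list_injective {α : Type} [Enc α] (h : Function.Injective (enc : α → Datum)) :
    Function.Injective (enc : List α → Datum) := by
  intro l
  induction l with
  | nil => intro m hm; exact (PolyTime.enc_list_eq_nil.1 hm.symm).symm
  | cons a l ih =>
    intro m hm
    cases m with
    | nil => simp [enc_cons, enc_nil] at hm
    | cons b m =>
      rw [enc_cons, enc_cons] at hm
      injection hm with h1 h2
      rw [h h1, ih h2]

theorem enc_lists_injective : Function.Injective (enc : List (List ℕ) → Datum) :=
  enc_list_injective (enc_list_injective enc_nat_injective)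

/-- The list of the ends of each edge. -/
def ends (E : List (ℕ × ℕ)) : List (List ℕ) := E.map fun e => [e.1, e.2]

theorem ends_injective : Function.Injective ends :=
  List.map_injective_iff.2 fun e f h => by
    simp only [List.cons.injEq, and_true] at h
    exact Prod.ext h.1 h.2

theorem map_toPair_ends (E : List (ℕ × ℕ)) : (ends E).map toPair = E := by
  simp [ends, toPair, Function.comp_def]

theorem len_ends (E : List (ℕ × ℕ)) : len (ends E) = len E + 2 * E.length := by
  unfold ends
  induction E with
  | nil => simp
  | cons e E ih =>
    obtain ⟨u, v⟩ := e
    simp at ih ⊢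
    omega

namespace GraphWithDecomposition

def raw (x : GraphWithDecomposition) : RawGraph := (x.n, ends x.edges, x.bags, ends x.links)

theorem ofList_edges (E : List (ℕ × ℕ)) :
    Datum.ofList (fun e : ℕ × ℕ => Datum.ofList Datum.ofNat [e.1, e.2]) E = enc (ends E) := by
  induction E with
  | nil => rfl
  | cons e E ih =>
    rw [Datum.ofList, ih]
    rfl

theorem encode_eq (x : GraphWithDecomposition) : x.encode = enc x.raw := by
  unfold encode
  simp only [ofList_edges]
  rfl

/-- The word determines the instance, so the existential quantifier over instances in the value is
harmless. -/
theorem encode_injective : Function.Injective encode := by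
  intro x y h
  rw [encode_eq, encode_eq] at h
  unfold raw at h
  simp only [enc_pair, Datum.cons.injEq] at h
  obtain ⟨h1, h2, h3, h4⟩ := h
  have h1 := enc_nat_injective h1
  have h2 := ends_injective (enc_lists_injective h2)
  have h3 := enc_lists_injective h3
  have h4 := ends_injective (enc_lists_injective h4)
  cases x
  cases y
  simp_all

theorem input_eq (x : GraphWithDecomposition) (k : ℕ) : input x.encode k = enc (x.raw, k) := by
  rw [encode_eq]
  rfl

end GraphWithDecomposition

theorem listGraph_adj {n : ℕ} {E : List (ℕ × ℕ)} (hE : ∀ e ∈ E, e.1 < e.2) {u v : Fin n}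
    (huv : u.val < v.val) : (listGraph n E).Adj u v ↔ (u.val, v.val) ∈ E := by
  unfold listGraph
  rw [SimpleGraph.fromRel_adj]
  constructor
  · rintro ⟨-, h | h⟩
    · exact h
    · have := hE _ h
      simp at this
      omega
  · intro h
    exact ⟨by rintro rfl; omega, .inl h⟩

theorem isEdgeCliqueCover_iff {n : ℕ} {E : List (ℕ × ℕ)} {L : List (List ℕ)}
    (hE : IsEdgeList n E) (hL : ∀ C ∈ L, ∀ v ∈ C, v < n) :
    IsEdgeCliqueCover (listGraph n E) (L.map (listSet n)) ↔ ListCover E L := by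
  have hlt : ∀ e ∈ E, e.1 < e.2 := fun e he => (hE.2 e he).1
  have hm : ∀ (C : List ℕ) (v : Fin n), v ∈ listSet n C ↔ v.val ∈ C := by simp [listSet]
  constructor
  · rintro ⟨h1, h2⟩
    refine ⟨fun C hC u hu v hv huv => ?_, fun e he => ?_⟩
    · have := h1 _ (List.mem_map_of_mem hC) (x := ⟨u, hL C hC u hu⟩) (by simpa [hm] using hu)
        (y := ⟨v, hL C hC v hv⟩) (by simpa [hm] using hv) (by simp; omega)
      exact (listGraph_adj hlt huv).1 this
    · have h := hE.2 e he
      obtain ⟨C, hC, hu, hv⟩ := h2 ⟨e.1, by omega⟩ ⟨e.2, by omega⟩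
        ((listGraph_adj hlt h.1).2 he)
      obtain ⟨C, hC', rfl⟩ := List.mem_map.1 hC
      exact ⟨C, hC', by simpa [hm] using hu, by simpa [hm] using hv⟩
  · rintro ⟨h1, h2⟩
    refine ⟨fun C hC u hu v hv huv => ?_, fun u v huv => ?_⟩
    · obtain ⟨C, hC', rfl⟩ := List.mem_map.1 hC
      rw [Finset.mem_coe, hm] at hu hv
      rcases lt_trichotomy u.val v.val with h | h | h
      · exact (listGraph_adj hlt h).2 (h1 C hC' _ hu _ hv h)
      · exact absurd (Fin.ext h) huv
      · exact ((listGraph_adj hlt h).2 (h1 C hC' _ hv _ hu h)).symm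
    · rcases lt_trichotomy u.val v.val with h | h | h
      · obtain ⟨C, hC, hu, hv⟩ := h2 _ ((listGraph_adj hlt h).1 huv)
        exact ⟨_, List.mem_map_of_mem hC, (hm _ _).2 hu, (hm _ _).2 hv⟩
      · exact absurd (Fin.ext h) huv.ne
      · obtain ⟨C, hC, hu, hv⟩ := h2 _ ((listGraph_adj hlt h).1 huv.symm)
        exact ⟨_, List.mem_map_of_mem hC, (hm _ _).2 hv, (hm _ _).2 hu⟩

/-! ### Value and optimum in terms of list covers -/

section Value

variable {x : GraphWithDecomposition} {ℓ : ℕ}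

theorem value_le (hx : x.Valid ℓ) {L : List (List ℕ)} (hL : ∀ C ∈ L, ∀ v ∈ C, v < x.n)
    (h : ListCover x.edges L) :
    edgeCliqueCover.value x.encode ℓ (enc L) ≤ (L.length : EReal) :=
  sInf_le ⟨x, L, rfl, hx, rfl, hL, (isEdgeCliqueCover_iff hx.edges_ok hL).2 h, rfl⟩

/-- By injectivity of the encodings the infimum ranges over at most one number; it is finite exactly
when `s` describes a cover. -/
theorem exists_of_value_lt_top {s : Datum} (h : edgeCliqueCover.value x.encode ℓ s < ⊤) :
    ∃ L : List (List ℕ), s = enc L ∧ (∀ C ∈ L, ∀ v ∈ C, v < x.n) ∧ ListCover x.edges L ∧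
      edgeCliqueCover.value x.encode ℓ s = (L.length : EReal) := by
  obtain ⟨r, ⟨y, L, hy, hyv, hs, hL, hc, rfl⟩, -⟩ := sInf_lt_iff.1 h
  obtain rfl := GraphWithDecomposition.encode_injective hy
  have hc' := (isEdgeCliqueCover_iff hyv.edges_ok hL).1 hc
  refine ⟨L, hs, hL, hc', le_antisymm (hs ▸ value_le hyv hL hc') (le_sInf ?_)⟩
  rintro r ⟨z, L', hz, hzv, hs', -, -, rfl⟩
  rw [enc_lists_injective (hs'.symm.trans hs : enc L' = enc L)]

theorem len_ends_edges_le : len (ends x.edges) ≤ x.encode.size := by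
  rw [x.encode_eq]
  change _ ≤ len (x.n, ends x.edges, x.bags, ends x.links)
  simp only [len_pair]
  omega

/-- An optimal cover may be too long as a word, for it may contain useless vertices and repetitions.
Its shrunk form has no more sets and fits into the length of the edge list. -/
theorem opt_eq (hx : x.Valid ℓ) :
    edgeCliqueCover.opt x.encode ℓ = ((coverNumber x.edges : ℕ) : EReal) := by
  have hlt : ∀ e ∈ x.edges, e.1 < e.2 := fun e he => (hx.edges_ok.2 e he).1
  apply le_antisymm
  · obtain ⟨L, hL, hlen⟩ := exists_listCover hlt
    have hb : ∀ C ∈ shrink x.edges L, ∀ v ∈ C, v < x.n := fun C hC v hv => by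
      obtain ⟨e, he, h⟩ := mem_shrink hC hv
      have := hx.edges_ok.2 e he
      omega
    have hmem : ∃ s : Datum, s.size ≤ x.encode.size + ℓ ∧
        edgeCliqueCover.value x.encode ℓ (enc (shrink x.edges L)) =
          edgeCliqueCover.value x.encode ℓ s := ⟨enc (shrink x.edges L), ?_, rfl⟩
    · have h0 : edgeCliqueCover.opt x.encode ℓ ≤
        edgeCliqueCover.value x.encode ℓ (enc (shrink x.edges L)) := sInf_le hmem
      refine h0.trans ((value_le hx hb hL.shrink).trans ?_)
      have := length_shrink_le x.edges L
      rw [hlen] at this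
      exact_mod_cast this
    · have h1 := len_shrink_le x.edges L
      rw [← len_ends] at h1
      exact h1.trans (len_ends_edges_le.trans (Nat.le_add_right _ _))
  · refine le_sInf ?_
    rintro r ⟨s, -, rfl⟩
    by_cases h : edgeCliqueCover.value x.encode ℓ s < ⊤
    · obtain ⟨L, -, -, hc, he⟩ := exists_of_value_lt_top h
      rw [he]
      exact_mod_cast coverNumber_le hc
    · rw [not_lt_top_iff.1 h]
      exact le_top

theorem isApproxSolution_iff (hx : x.Valid ℓ) {r : ℝ} {s : Datum} :
    edgeCliqueCover.IsApproxSolution r x.encode ℓ s ↔ s.size ≤ x.encode.size + ℓ ∧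
      ∃ L : List (List ℕ), s = enc L ∧ (∀ C ∈ L, ∀ v ∈ C, v < x.n) ∧ ListCover x.edges L ∧
        (L.length : ℝ) ≤ r * coverNumber x.edges := by
  have hr : (r : EReal) * ((coverNumber x.edges : ℕ) : EReal) =
      ((r * coverNumber x.edges : ℝ) : EReal) := by
    rw [EReal.coe_mul]
    norm_cast
  unfold MinProblem.IsApproxSolution
  rw [opt_eq hx, hr]
  refine and_congr_right fun _ => ⟨fun h => ?_, ?_⟩
  · obtain ⟨L, h1, h2, h3, h4⟩ := exists_of_value_lt_top (h.trans_lt (EReal.coe_lt_top _))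
    rw [h4] at h
    exact ⟨L, h1, h2, h3, by exact_mod_cast h⟩
  · rintro ⟨L, rfl, h2, h3, h4⟩
    exact (value_le hx h2 h3).trans (by exact_mod_cast h4)

end Value

/-! ## Splitting a graph along small separators -/

/-- `P` arises from the vertex set `R` by repeatedly cutting off a set of at least `m + b` vertices
that meets the rest in at most `b` vertices. -/
inductive SplitsInto (E : List (ℕ × ℕ)) (b m : ℕ) : Finset ℕ → List (List ℕ) → Prop
  | last (Y : List ℕ) : SplitsInto E b m Y.toFinset [Y]
  | cut {R : Finset ℕ} {Y : List ℕ} {P : List (List ℕ)} : SplitsInto E b m R P →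
      (∀ e ∈ E, e.1 ∈ Y.toFinset ∪ R → e.2 ∈ Y.toFinset ∪ R →
        e.1 ∈ Y ∧ e.2 ∈ Y ∨ e.1 ∈ R ∧ e.2 ∈ R) →
      (Y.toFinset ∩ R).card ≤ b → m + b ≤ Y.toFinset.card →
      SplitsInto E b m (Y.toFinset ∪ R) (Y :: P)

theorem length_spanned_le {E : List (ℕ × ℕ)} (hE : E.Nodup) (B : List ℕ) :
    (spanned E B).length ≤ B.toFinset.card * B.toFinset.card := by
  have hn : (spanned E B).Nodup := hE.filter _
  rw [← Finset.card_product, ← List.toFinset_card_of_nodup hn]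
  refine Finset.card_le_card fun e he => ?_
  have := mem_spanned.1 (List.mem_toFinset.1 he)
  simpa using this.2

/-- A vertex outside `Y` and a vertex outside `R` would be joined by an edge lying on neither side.
-/
theorem clique_subset_or {E : List (ℕ × ℕ)} {Y : List ℕ} {R : Finset ℕ} {C : List ℕ}
    (hsep : ∀ e ∈ E, e.1 ∈ Y.toFinset ∪ R → e.2 ∈ Y.toFinset ∪ R →
      e.1 ∈ Y ∧ e.2 ∈ Y ∨ e.1 ∈ R ∧ e.2 ∈ R)
    (hC : ∀ u ∈ C, ∀ v ∈ C, u < v → (u, v) ∈ E) (hCR : ∀ v ∈ C, v ∈ Y.toFinset ∪ R) :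
    (∀ v ∈ C, v ∈ Y) ∨ ∀ v ∈ C, v ∈ R := by
  by_contra! h
  obtain ⟨⟨u, hu, huY⟩, w, hw, hwR⟩ := h
  rcases lt_trichotomy u w with h | rfl | h
  · rcases hsep _ (hC u hu w hw h) (hCR u hu) (hCR w hw) with h' | h'
    · exact huY h'.1
    · exact hwR h'.2
  · simpa [huY, hwR] using hCR u hu
  · rcases hsep _ (hC w hw u hu h) (hCR w hw) (hCR u hu) with h' | h'
    · exact huY h'.2
    · exact hwR h'.1

/-- At a cut let `B` be the overlap. The cliques of `L` inside `Y` together with the single edges of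
`B` cover `Y`; the other cliques, which lie in `R`, together with the same edges cover `R`, and the
induction continues with that cover. This explains why `L` is arbitrary. The term `2 * (b * b)` on
the left expresses that there is one cut fewer than pieces. -/
theorem SplitsInto.sum_coverNumber_le {E : List (ℕ × ℕ)} {b m : ℕ} {R : Finset ℕ}
    {P : List (List ℕ)} (h : SplitsInto E b m R P) (hE : E.Nodup) (hlt : ∀ e ∈ E, e.1 < e.2)
    {L : List (List ℕ)} (hcl : ∀ C ∈ L, ∀ u ∈ C, ∀ v ∈ C, u < v → (u, v) ∈ E)
    (hsub : ∀ C ∈ L, ∀ v ∈ C, v ∈ R)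
    (hcov : ∀ e ∈ E, e.1 ∈ R → e.2 ∈ R → ∃ C ∈ L, e.1 ∈ C ∧ e.2 ∈ C) :
    (P.map fun Y => coverNumber (spanned E Y)).sum + 2 * (b * b) ≤
      L.length + P.length * (2 * (b * b)) := by
  induction h generalizing L with
  | last Y =>
    have : coverNumber (spanned E Y) ≤ L.length := coverNumber_le
      ⟨fun C hC u hu v hv huv => mem_spanned.2 ⟨hcl C hC u hu v hv huv,
        List.mem_toFinset.1 (hsub C hC u hu), List.mem_toFinset.1 (hsub C hC v hv)⟩,
        fun e he => by
          have := mem_spanned.1 he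
          exact hcov e this.1 (by simp [this]) (by simp [this])⟩
    simpa using this
  | @cut R Y P _ hsep hb _ ih =>
    set B : List ℕ := Y.filter fun v => decide (v ∈ R) with hB
    have hmB : ∀ {v}, v ∈ B ↔ v ∈ Y ∧ v ∈ R := by simp [hB]
    have hBlen : (spanned E B).length ≤ b * b := by
      have h1 : B.toFinset.card ≤ b := by
        rwa [hB, List.toFinset_filter, show Y.toFinset.filter (fun v => decide (v ∈ R) = true) =
          Y.toFinset ∩ R by ext; simp]
      exact (length_spanned_le hE B).trans (Nat.mul_le_mul h1 h1)
    have hends : ListCover (spanned E B) (ends (spanned E B)) :=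
      listCover_edges fun e he => hlt e (mem_spanned.1 he).1
    have hendsB : ∀ C ∈ ends (spanned E B), ∀ v ∈ C, v ∈ B := by
      intro C hC v hv
      obtain ⟨e, he, rfl⟩ := List.mem_map.1 hC
      have := mem_spanned.1 he
      simp only [List.mem_cons, List.not_mem_nil, or_false] at hv
      rcases hv with rfl | rfl
      · exact this.2.1
      · exact this.2.2
    set q : List ℕ → Bool := fun C => decide (∀ v ∈ C, v ∈ Y) with hq
    have hL2 : ∀ C ∈ L.filter (fun C => !q C), ∀ v ∈ C, v ∈ R := by
      intro C hC
      rw [List.mem_filter] at hC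
      rcases clique_subset_or hsep (hcl C hC.1) (hsub C hC.1) with h | h
      · simp [hq] at hC
        obtain ⟨-, w, hw, hw'⟩ := hC
        exact absurd (h w hw) hw'
      · exact h
    have h1 : coverNumber (spanned E Y) ≤ (L.filter q ++ ends (spanned E B)).length := by
      refine coverNumber_le ⟨fun C hC u hu v hv huv => ?_, fun e he => ?_⟩
      · rcases List.mem_append.1 hC with hC | hC
        · rw [List.mem_filter] at hC
          have hCY : ∀ v ∈ C, v ∈ Y := by simpa [hq] using hC.2
          exact mem_spanned.2 ⟨hcl C hC.1 u hu v hv huv, hCY u hu, hCY v hv⟩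
        · have := mem_spanned.1 (hends.clique C hC u hu v hv huv)
          exact mem_spanned.2 ⟨this.1, (hmB.1 this.2.1).1, (hmB.1 this.2.2).1⟩
      · obtain ⟨he, h1, h2⟩ := mem_spanned.1 he
        obtain ⟨C, hC, hC1, hC2⟩ := hcov e he (by simp [h1]) (by simp [h2])
        by_cases hCq : q C
        · exact ⟨C, by simp [hC, hCq], hC1, hC2⟩
        · have hR := hL2 C (by simp [hC, hCq])
          obtain ⟨D, hD, hD'⟩ := hends.cover e
            (mem_spanned.2 ⟨he, hmB.2 ⟨h1, hR _ hC1⟩, hmB.2 ⟨h2, hR _ hC2⟩⟩)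
          exact ⟨D, by simp [hD], hD'⟩
    have h2 := ih (L := L.filter (fun C => !q C) ++ ends (spanned E B))
      (fun C hC u hu v hv huv => by
        rcases List.mem_append.1 hC with hC | hC
        · exact hcl C (List.mem_filter.1 hC).1 u hu v hv huv
        · exact (mem_spanned.1 (hends.clique C hC u hu v hv huv)).1)
      (fun C hC v hv => by
        rcases List.mem_append.1 hC with hC | hC
        · exact hL2 C hC v hv
        · exact (hmB.1 (hendsB C hC v hv)).2)
      (fun e he h1 h2 => by
        obtain ⟨C, hC, hC1, hC2⟩ := hcov e he (by simp [h1]) (by simp [h2])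
        by_cases hCq : q C
        · have hCY : ∀ v ∈ C, v ∈ Y := by simpa [hq] using hCq
          obtain ⟨D, hD, hD'⟩ := hends.cover e
            (mem_spanned.2 ⟨he, hmB.2 ⟨hCY _ hC1, h1⟩, hmB.2 ⟨hCY _ hC2, h2⟩⟩)
          exact ⟨D, by simp [hD], hD'⟩
        · exact ⟨C, by simp [hC, hCq], hC1, hC2⟩)
    have h3 := length_filter_not_add q L
    simp only [List.length_append, List.map_cons, List.sum_cons, List.length_cons, ends,
      List.length_map, add_mul, one_mul] at h1 h2 ⊢
    omega

/-- A cut piece has at least m+b vertices and shares at most b of them with the rest, so at least m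
vertices disappear. -/
theorem SplitsInto.length_mul_le {E : List (ℕ × ℕ)} {b m : ℕ} {R : Finset ℕ}
    {P : List (List ℕ)} (h : SplitsInto E b m R P) : P.length * m ≤ R.card + m := by
  induction h with
  | last Y => simp
  | @cut R Y P _ _ hb hm ih =>
    have := Finset.card_union_add_card_inter Y.toFinset R
    simp only [List.length_cons, add_mul]
    omega

theorem SplitsInto.exists_mem {E : List (ℕ × ℕ)} {b m : ℕ} {R : Finset ℕ}
    {P : List (List ℕ)} (h : SplitsInto E b m R P) {e : ℕ × ℕ} (he : e ∈ E) (h1 : e.1 ∈ R)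
    (h2 : e.2 ∈ R) : ∃ Y ∈ P, e.1 ∈ Y ∧ e.2 ∈ Y := by
  induction h with
  | last Y => exact ⟨Y, by simp, by simpa using h1, by simpa using h2⟩
  | @cut R Y P _ hsep _ _ ih =>
    rcases hsep e he h1 h2 with h | h
    · exact ⟨Y, by simp, h⟩
    · obtain ⟨Z, hZ, h⟩ := ih h.1 h.2
      exact ⟨Z, by simp [hZ], h⟩

/-! ## The pieces cut off along a tree decomposition -/

/-- The nodes of an order of the tree, with the root `0`. -/
def nodes (ord : List (ℕ × ℕ)) : List ℕ := 0 :: ord.map Prod.fst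

/-- Every node of the order comes with an earlier node whose set contains everything that the set
of the node has in common with the sets of earlier nodes. -/
def RunningIntersection (X : ℕ → List ℕ) : List (ℕ × ℕ) → Prop
  | [] => True
  | e :: ord => RunningIntersection X ord ∧ e.1 ∉ nodes ord ∧ e.2 ∈ nodes ord ∧
      ∀ q ∈ nodes ord, ∀ v, v ∈ X e.1 → v ∈ X q → v ∈ X e.2

theorem mem_restrict {vs A : List ℕ} {v : ℕ} : v ∈ restrict vs A ↔ v ∈ vs ∧ v ∈ A := by
  simp [restrict]

theorem look_cons (vs : List ℕ) (bags : List (List ℕ)) (p : ℕ) (Z : List ℕ)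
    (acc : List (ℕ × List ℕ)) (t : ℕ) :
    look vs bags ((p, Z) :: acc) t = if t = p then Z else look vs bags acc t := by
  unfold look
  by_cases h : t = p
  · subst h
    simp
  · simp [h, Ne.symm h]

/-- What is known of the sets stored at the nodes while pieces are being cut off. -/
structure Stored (E : List (ℕ × ℕ)) (vs : List ℕ) (X y : ℕ → List ℕ) (M : ℕ) (N : List ℕ) :
    Prop where
  bag_subset : ∀ j ∈ N, ∀ v ∈ vs, v ∈ X j → v ∈ y j
  inter : ∀ j ∈ N, ∀ k ∈ N, j ≠ k → ∀ v, v ∈ y j → v ∈ y k → v ∈ X j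
  edge : ∀ e ∈ E, ∀ i ∈ N, ∀ j ∈ N, e.1 ∈ y i → e.2 ∈ y j → ∃ k ∈ N, e.1 ∈ y k ∧ e.2 ∈ y k
  sublist : ∀ j ∈ N, (y j).Sublist vs
  length_lt : ∀ j ∈ N, (y j).length < M

theorem Stored.congr {E : List (ℕ × ℕ)} {vs : List ℕ} {X y z : ℕ → List ℕ} {M : ℕ} {N : List ℕ}
    (h : Stored E vs X y M N) (hyz : ∀ j, z j = y j) : Stored E vs X z M N :=
  (funext hyz : z = y) ▸ h

/-! ### Merging into the parent and cutting off preserve the invariant -/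

section Step

variable {E : List (ℕ × ℕ)} {vs : List ℕ} {X y : ℕ → List ℕ} {M : ℕ} {t p : ℕ} {N : List ℕ}

theorem Stored.mem_union (h : Stored E vs X y M (t :: N)) (hp : p ∈ N) {v : ℕ} :
    v ∈ restrict vs (y t ++ y p) ↔ v ∈ y t ∨ v ∈ y p := by
  rw [mem_restrict, List.mem_append]
  refine ⟨fun h => h.2, fun hv => ⟨?_, hv⟩⟩
  rcases hv with hv | hv
  · exact (h.sublist t (by simp)).subset hv
  · exact (h.sublist p (by simp [hp])).subset hv

/-- Sets stored at different nodes meet only inside the bags of both nodes, so what `t` shares with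
other nodes passes through the bag of its parent `p`. -/
theorem Stored.inter_union (h : Stored E vs X y M (t :: N)) (ht : t ∉ N) (hp : p ∈ N)
    (hX : ∀ q ∈ N, ∀ v, v ∈ X t → v ∈ X q → v ∈ X p) {k v : ℕ} (hk : k ∈ N) (hkp : k ≠ p)
    (hv : v ∈ y t ∨ v ∈ y p) (hvk : v ∈ y k) : v ∈ X p ∧ v ∈ X k := by
  have htk : t ≠ k := fun h => ht (h ▸ hk)
  rcases hv with hv | hv
  · have h1 := h.inter t (by simp) k (by simp [hk]) htk v hv hvk
    have h2 := h.inter k (by simp [hk]) t (by simp) htk.symm v hvk hv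
    exact ⟨hX k hk v h1 h2, h2⟩
  · exact ⟨h.inter p (by simp [hp]) k (by simp [hk]) hkp.symm v hv hvk,
      h.inter k (by simp [hk]) p (by simp [hp]) hkp v hvk hv⟩

theorem Stored.merge (h : Stored E vs X y M (t :: N)) (ht : t ∉ N) (hp : p ∈ N)
    (hX : ∀ q ∈ N, ∀ v, v ∈ X t → v ∈ X q → v ∈ X p)
    (hM : (restrict vs (y t ++ y p)).length < M) :
    Stored E vs X (fun j => if j = p then restrict vs (y t ++ y p) else y j) M N := by
  refine ⟨fun j hj v hv hvX => ?_, fun j hj k hk hjk v hvj hvk => ?_, fun e he i hi j hj h1 h2 => ?_,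
    fun j hj => ?_, fun j hj => ?_⟩
  · have := h.bag_subset j (by simp [hj]) v hv hvX
    split_ifs with hjp
    · rw [h.mem_union hp]
      exact .inr (hjp ▸ this)
    · exact this
  · split_ifs at hvj hvk with hjp hkp hkp
    · exact absurd (hjp.trans hkp.symm) hjk
    · rw [h.mem_union hp] at hvj
      exact hjp ▸ (h.inter_union ht hp hX hk hkp hvj hvk).1
    · rw [h.mem_union hp] at hvk
      exact (h.inter_union ht hp hX hj hjp hvk hvj).2
    · exact h.inter j (by simp [hj]) k (by simp [hk]) hjk v hvj hvk
  · have key : ∀ u i, i ∈ N → u ∈ (if i = p then restrict vs (y t ++ y p) else y i) →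
        ∃ i' ∈ t :: N, u ∈ y i' := by
      intro u i hi hu
      split_ifs at hu with hip
      · rcases (h.mem_union hp).1 hu with hu | hu
        · exact ⟨t, by simp, hu⟩
        · exact ⟨p, by simp [hp], hu⟩
      · exact ⟨i, by simp [hi], hu⟩
    obtain ⟨i', hi', h3⟩ := key _ i hi h1
    obtain ⟨j', hj', h4⟩ := key _ j hj h2
    obtain ⟨k, hk, h5, h6⟩ := h.edge e he i' hi' j' hj' h3 h4
    by_cases hkp : k = t ∨ k = p
    · refine ⟨p, hp, ?_⟩
      simp only [if_true, h.mem_union hp]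
      rcases hkp with rfl | rfl
      · exact ⟨.inl h5, .inl h6⟩
      · exact ⟨.inr h5, .inr h6⟩
    · push Not at hkp
      refine ⟨k, ?_, ?_⟩
      · simpa [hkp.1] using hk
      · simpa [hkp.2] using ⟨h5, h6⟩
  · split_ifs
    · exact List.filter_sublist
    · exact h.sublist j (by simp [hj])
  · split_ifs
    · exact hM
    · exact h.length_lt j (by simp [hj])

/-- The parent's bag separates the cut piece from the rest. This bounds the overlap and keeps edges
whole. -/
theorem Stored.mem_bag_of_cut (h : Stored E vs X y M (t :: N)) (ht : t ∉ N) (hp : p ∈ N)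
    (hX : ∀ q ∈ N, ∀ v, v ∈ X t → v ∈ X q → v ∈ X p) {k v : ℕ} (hk : k ∈ N)
    (hv : v ∈ y t ∨ v ∈ y p) (hvk : v ∈ if k = p then restrict vs (X p) else y k) :
    v ∈ restrict vs (X p) := by
  split_ifs at hvk with hkp
  · exact hvk
  · exact mem_restrict.2 ⟨(h.sublist k (by simp [hk])).subset hvk,
      (h.inter_union ht hp hX hk hkp hv hvk).1⟩

theorem Stored.mem_of_cut (h : Stored E vs X y M (t :: N)) (hp : p ∈ N) {k v : ℕ}
    (hvk : v ∈ if k = p then restrict vs (X p) else y k) : v ∈ y k := by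
  split_ifs at hvk with hkp
  · rw [mem_restrict] at hvk
    exact hkp ▸ h.bag_subset p (by simp [hp]) v hvk.1 hvk.2
  · exact hvk

/-- The critical clause is `edge`: if the node storing an edge is `t` or `p`, but both ends survive
the cut, then both ends lie in the bag of `p`, which is kept. -/
theorem Stored.cut (h : Stored E vs X y M (t :: N)) (ht : t ∉ N) (hp : p ∈ N)
    (hX : ∀ q ∈ N, ∀ v, v ∈ X t → v ∈ X q → v ∈ X p)
    (hM : (restrict vs (X p)).length < M) :
    Stored E vs X (fun j => if j = p then restrict vs (X p) else y j) M N := by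
  refine ⟨fun j hj v hv hvX => ?_, fun j hj k hk hjk v hvj hvk => ?_, fun e he i hi j hj h1 h2 => ?_,
    fun j hj => ?_, fun j hj => ?_⟩
  · split_ifs with hjp
    · exact mem_restrict.2 ⟨hv, hjp ▸ hvX⟩
    · exact h.bag_subset j (by simp [hj]) v hv hvX
  · exact h.inter j (by simp [hj]) k (by simp [hk]) hjk v (h.mem_of_cut hp hvj)
      (h.mem_of_cut hp hvk)
  · obtain ⟨k, hk, h3, h4⟩ := h.edge e he i (by simp [hi]) j (by simp [hj]) (h.mem_of_cut hp h1)
      (h.mem_of_cut hp h2)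
    by_cases hkp : k = t ∨ k = p
    · refine ⟨p, hp, ?_⟩
      simp only [if_true]
      constructor
      · refine h.mem_bag_of_cut ht hp hX hi ?_ h1
        rcases hkp with rfl | rfl
        · exact .inl h3
        · exact .inr h3
      · refine h.mem_bag_of_cut ht hp hX hj ?_ h2
        rcases hkp with rfl | rfl
        · exact .inl h4
        · exact .inr h4
    · push Not at hkp
      refine ⟨k, ?_, ?_⟩
      · simpa [hkp.1] using hk
      · simpa [hkp.2] using ⟨h3, h4⟩
  · split_ifs
    · exact List.filter_sublist
    · exact h.sublist j (by simp [hj])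
  · split_ifs
    · exact hM
    · exact h.length_lt j (by simp [hj])

end Step

/-- The union of the sets stored at the nodes. -/
def union (y : ℕ → List ℕ) (N : List ℕ) : Finset ℕ := N.toFinset.biUnion fun j => (y j).toFinset

theorem mem_union {y : ℕ → List ℕ} {N : List ℕ} {v : ℕ} : v ∈ union y N ↔ ∃ j ∈ N, v ∈ y j := by
  simp [union]

/-- The order lists the last nodes first, so a node is removed after all its children, and the
running intersection property holds for the nodes that remain. -/
theorem carve_spec {E : List (ℕ × ℕ)} {vs : List ℕ} {bags : List (List ℕ)} {b m M : ℕ}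
    (hvs : vs.Nodup) (hM : m + b ≤ M) (hm : 0 < m) (ord : List (ℕ × ℕ))
    (acc : List (ℕ × List ℕ)) (out : List (List ℕ))
    (hord : RunningIntersection (fun t => bags.getD t []) ord)
    (hbag : ∀ t ∈ nodes ord, (restrict vs (bags.getD t [])).length ≤ b)
    (hy : Stored E vs (fun t => bags.getD t []) (look vs bags acc) M (nodes ord)) :
    ∃ P, carveEnd vs bags (ord.foldl (carveStep vs bags M) (acc, out)) = P.reverse ++ out ∧
      SplitsInto E b m (union (look vs bags acc) (nodes ord)) P ∧
      ∀ Y ∈ P, Y.Sublist vs ∧ Y.length ≤ 2 * M := by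
  induction ord generalizing acc out with
  | nil =>
    refine ⟨[look vs bags acc 0], rfl, ?_, fun Y hY => ?_⟩
    · have : union (look vs bags acc) (nodes []) = (look vs bags acc 0).toFinset := by
        ext
        simp [union, nodes]
      rw [this]
      exact .last _
    · obtain rfl := List.mem_singleton.1 hY
      have := hy.length_lt 0 (by simp [nodes])
      exact ⟨hy.sublist 0 (by simp [nodes]), by omega⟩
  | cons e ord ih =>
    obtain ⟨t, p⟩ := e
    obtain ⟨hri, ht, hp, hX⟩ := hord
    dsimp only at ht hp hX
    have hnodes : ∀ j, j ∈ nodes ((t, p) :: ord) ↔ j ∈ t :: nodes ord := by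
      intro j
      simp [nodes]
      tauto
    have hy' : Stored E vs (fun t => bags.getD t []) (look vs bags acc) M (t :: nodes ord) := by
      obtain ⟨h1, h2, h3, h4, h5⟩ := hy
      simp only [hnodes] at h1 h2 h3 h4 h5
      exact ⟨h1, h2, h3, h4, h5⟩
    have hbag' : ∀ t ∈ nodes ord, (restrict vs (bags.getD t [])).length ≤ b :=
      fun j hj => hbag j ((hnodes j).2 (by simp [hj]))
    have hmemU : ∀ v, v ∈ union (look vs bags acc) (nodes ((t, p) :: ord)) ↔
        v ∈ look vs bags acc t ∨ ∃ j ∈ nodes ord, v ∈ look vs bags acc j := by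
      intro v
      simp [mem_union, hnodes]
    set Z := restrict vs (look vs bags acc t ++ look vs bags acc p) with hZ
    have hmemZ : ∀ v, v ∈ Z ↔ v ∈ look vs bags acc t ∨ v ∈ look vs bags acc p :=
      fun v => hy'.mem_union hp
    have hZn : Z.Nodup := hvs.filter _
    rw [List.foldl_cons]
    by_cases hc : M ≤ Z.length
    · have hstep : carveStep vs bags M (acc, out) (t, p) =
          ((p, restrict vs (bags.getD p [])) :: acc, Z :: out) := if_pos hc
      rw [hstep]
      have hpb : (restrict vs (bags.getD p [])).length ≤ b := hbag' p hp
      have hst := (hy'.cut ht hp hX (by omega)).congr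
        (fun j => look_cons vs bags p (restrict vs (bags.getD p [])) acc j)
      obtain ⟨P, hP, hS, hY⟩ := ih _ (Z :: out) hri hbag' hst
      have hU : union (look vs bags acc) (nodes ((t, p) :: ord)) = Z.toFinset ∪
          union (look vs bags ((p, restrict vs (bags.getD p [])) :: acc)) (nodes ord) := by
        ext v
        rw [hmemU, Finset.mem_union, List.mem_toFinset, hmemZ, mem_union]
        simp only [look_cons]
        constructor
        · rintro (h | ⟨j, hj, h⟩)
          · exact .inl (.inl h)
          · by_cases hjp : j = p
            · exact .inl (.inr (hjp ▸ h))
            · exact .inr ⟨j, hj, by simpa [hjp] using h⟩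
        · rintro ((h | h) | ⟨j, hj, h⟩)
          · exact .inl h
          · exact .inr ⟨p, hp, h⟩
          · exact .inr ⟨j, hj, hy'.mem_of_cut (X := fun t => bags.getD t []) hp h⟩
      refine ⟨Z :: P, by rw [hP]; simp, ?_, fun Y hYm => ?_⟩
      · rw [hU]
        -- An edge stored at `t` or `p` belongs to the piece `Z`; one stored at any other node is
        -- untouched and belongs to the rest.
        refine .cut hS (fun e he h1 h2 => ?_) ?_ ?_
        · rw [← hU, hmemU] at h1 h2
          obtain ⟨i, hi, h1⟩ : ∃ j ∈ t :: nodes ord, e.1 ∈ look vs bags acc j := by simpa using h1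
          obtain ⟨j, hj, h2⟩ : ∃ j ∈ t :: nodes ord, e.2 ∈ look vs bags acc j := by simpa using h2
          obtain ⟨k, hk, h3, h4⟩ := hy'.edge e he i hi j hj h1 h2
          by_cases hkp : k = t ∨ k = p
          · left
            rw [hmemZ, hmemZ]
            rcases hkp with rfl | rfl
            · exact ⟨.inl h3, .inl h4⟩
            · exact ⟨.inr h3, .inr h4⟩
          · push Not at hkp
            have hk' : k ∈ nodes ord := by simpa [hkp.1] using hk
            right
            simp only [mem_union, look_cons]
            exact ⟨⟨k, hk', by simpa [hkp.2] using h3⟩, ⟨k, hk', by simpa [hkp.2] using h4⟩⟩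
        · refine (Finset.card_le_card fun v hv => ?_).trans
            ((List.toFinset_card_le (restrict vs (bags.getD p []))).trans hpb)
          simp only [Finset.mem_inter, List.mem_toFinset, mem_union, look_cons] at hv
          obtain ⟨hv, k, hk, hvk⟩ := hv
          exact List.mem_toFinset.2 (hy'.mem_bag_of_cut ht hp hX hk ((hmemZ v).1 hv) hvk)
        · rw [List.toFinset_card_of_nodup hZn]
          exact hM.trans hc
      · rcases List.mem_cons.1 hYm with rfl | hYm
        · refine ⟨List.filter_sublist, ?_⟩
          -- Both merged sets were still below the threshold, whence the factor 2.
          have h1 := hy'.length_lt t (by simp)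
          have h2 := hy'.length_lt p (by simp [hp])
          rw [← List.toFinset_card_of_nodup hZn]
          have h3 : Z.toFinset ⊆
              (look vs bags acc t ++ look vs bags acc p).toFinset := fun v hv => by
            simpa using (hmemZ v).1 (List.mem_toFinset.1 hv)
          have h4 := (Finset.card_le_card h3).trans (List.toFinset_card_le _)
          rw [List.length_append] at h4
          exact h4.trans (by omega)
        · exact hY Y hYm
    · have hstep : carveStep vs bags M (acc, out) (t, p) = ((p, Z) :: acc, out) := if_neg hc
      rw [hstep]
      have hst := (hy'.merge ht hp hX (not_le.1 hc)).congr
        (fun j => look_cons vs bags p Z acc j)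
      obtain ⟨P, hP, hS, hY⟩ := ih _ out hri hbag' hst
      have hU : union (look vs bags acc) (nodes ((t, p) :: ord)) =
          union (look vs bags ((p, Z) :: acc)) (nodes ord) := by
        ext v
        rw [hmemU, mem_union]
        simp only [look_cons]
        constructor
        · rintro (h | ⟨j, hj, h⟩)
          · exact ⟨p, hp, by simpa using (hmemZ v).2 (.inl h)⟩
          · by_cases hjp : j = p
            · exact ⟨p, hp, by simpa using (hmemZ v).2 (.inr (hjp ▸ h))⟩
            · exact ⟨j, hj, by simpa [hjp] using h⟩
        · rintro ⟨j, hj, h⟩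
          split_ifs at h with hjp
          · rcases (hmemZ v).1 h with h | h
            · exact .inl h
            · exact .inr ⟨p, hp, h⟩
          · exact .inr ⟨j, hj, h⟩
      exact ⟨P, hP, hU ▸ hS, hY⟩

theorem SplitsInto.exists_length_eq {E : List (ℕ × ℕ)} {b m : ℕ} {R : Finset ℕ}
    {P : List (List ℕ)} (h : SplitsInto E b m R P) : ∃ q, P.length = q + 1 := by
  cases h <;> exact ⟨_, rfl⟩

/-! ## Orders of the nodes of a tree decomposition -/

/-- Orders of nodes in which every node but the root is linked to its parent. -/
inductive Grown (links : List (ℕ × ℕ)) : List (ℕ × ℕ) → Prop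
  | nil : Grown links []
  | cons {ord : List (ℕ × ℕ)} {t p : ℕ} : Grown links ord → (t, p) ∈ links ∨ (p, t) ∈ links →
      t ∉ nodes ord → p ∈ nodes ord → Grown links ((t, p) :: ord)

theorem reached_iff {ord : List (ℕ × ℕ)} {t : ℕ} : reached ord t = true ↔ t ∈ nodes ord := by
  simp [reached, nodes]

theorem nodes_subset_attach (ord : List (ℕ × ℕ)) (e : ℕ × ℕ) : nodes ord ⊆ nodes (attach ord e) := by
  unfold attach
  split_ifs <;> simp [nodes]

theorem mem_nodes_attach {ord : List (ℕ × ℕ)} {e : ℕ × ℕ} (h : e.1 ∈ nodes ord ∨ e.2 ∈ nodes ord) :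
    e.1 ∈ nodes (attach ord e) ∧ e.2 ∈ nodes (attach ord e) := by
  unfold attach
  split_ifs with h1 h2 h2 <;> rw [reached_iff] at h1 h2
  · exact ⟨h1, h2⟩
  · simp only [nodes, List.map_cons, List.mem_cons] at *
    tauto
  · simp only [nodes, List.map_cons, List.mem_cons] at *
    tauto
  · tauto

theorem Grown.attach {links ord : List (ℕ × ℕ)} {e : ℕ × ℕ} (h : Grown links ord)
    (he : e ∈ links) : Grown links (attach ord e) := by
  unfold TuringKernel.attach
  split_ifs with h1 h2 h2 <;> rw [reached_iff] at h1 h2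
  · exact h
  · exact .cons h (.inr he) h2 h1
  · exact .cons h (.inl he) h1 h2
  · exact h

theorem Grown.sweep {links ord : List (ℕ × ℕ)} (h : Grown links ord) :
    Grown links (sweep links ord) := by
  have : ∀ l : List (ℕ × ℕ), l ⊆ links → ∀ ord, Grown links ord →
      Grown links (l.foldl TuringKernel.attach ord) := by
    intro l
    induction l with
    | nil => exact fun _ _ h => h
    | cons e l ih =>
      intro hl ord h
      rw [List.cons_subset] at hl
      exact ih hl.2 _ (h.attach hl.1)
  exact this links (List.Subset.refl _) ord h

theorem nodes_subset_foldl_attach (l ord : List (ℕ × ℕ)) : nodes ord ⊆ nodes (l.foldl attach ord) := by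
  induction l generalizing ord with
  | nil => exact List.Subset.refl _
  | cons e l ih => exact List.Subset.trans (nodes_subset_attach ord e) (ih _)

theorem mem_nodes_sweep {links ord : List (ℕ × ℕ)} {e : ℕ × ℕ} (he : e ∈ links)
    (h : e.1 ∈ nodes ord ∨ e.2 ∈ nodes ord) :
    e.1 ∈ nodes (sweep links ord) ∧ e.2 ∈ nodes (sweep links ord) := by
  unfold sweep
  obtain ⟨l₁, l₂, rfl⟩ := List.append_of_mem he
  rw [List.foldl_append, List.foldl_cons]
  have h1 := nodes_subset_foldl_attach l₁ ord
  have h2 := mem_nodes_attach (h.imp (@h1 _) (@h1 _))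
  have h3 := nodes_subset_foldl_attach l₂ (attach (l₁.foldl attach ord) e)
  exact ⟨h3 h2.1, h3 h2.2⟩

theorem treeOrder_eq_iterate (bags : List (List ℕ)) (links : List (ℕ × ℕ)) :
    treeOrder bags links = (sweep links)^[bags.length] [] :=
  List.foldl_const _ _ _

theorem Grown.iterate {links ord : List (ℕ × ℕ)} (h : Grown links ord) (k : ℕ) :
    Grown links ((TuringKernel.sweep links)^[k] ord) := by
  induction k generalizing ord with
  | zero => exact h
  | succ k ih => exact ih h.sweep

theorem nodes_subset_iterate (links ord : List (ℕ × ℕ)) (k : ℕ) :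
    nodes ord ⊆ nodes ((sweep links)^[k] ord) := by
  induction k generalizing ord with
  | zero => exact List.Subset.refl _
  | succ k ih => exact List.Subset.trans (nodes_subset_foldl_attach links ord) (ih _)

/-- Each sweep advances at least one step along the walk. -/
theorem mem_nodes_of_walk {n : ℕ} {links : List (ℕ × ℕ)} {s t : Fin n}
    (w : (listGraph n links).Walk s t) {k : ℕ} (hk : w.length ≤ k) {ord : List (ℕ × ℕ)}
    (hs : s.val ∈ nodes ord) : t.val ∈ nodes ((sweep links)^[k] ord) := by
  induction w generalizing k ord with
  | nil => exact nodes_subset_iterate links ord k hs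
  | @cons s u t h w ih =>
    cases k with
    | zero => simp at hk
    | succ k =>
      rw [Function.iterate_succ_apply]
      refine ih (by simpa using hk) ?_
      rw [listGraph, SimpleGraph.fromRel_adj] at h
      rcases h.2 with h | h
      · exact (mem_nodes_sweep h (.inl hs)).2
      · exact (mem_nodes_sweep h (.inr hs)).1

theorem mem_nodes_treeOrder {bags : List (List ℕ)} {links : List (ℕ × ℕ)}
    (hT : (listGraph bags.length links).Connected) (t : Fin bags.length) :
    t.val ∈ nodes (treeOrder bags links) := by
  obtain ⟨w, hw⟩ := (hT.preconnected ⟨0, t.pos⟩ t).exists_isPath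
  rw [treeOrder_eq_iterate]
  refine mem_nodes_of_walk w ?_ (by simp [nodes])
  simpa using hw.length_lt.le

theorem Grown.lt {n : ℕ} {links ord : List (ℕ × ℕ)} (h : Grown links ord)
    (hl : IsEdgeList n links) (hn : 0 < n) {t : ℕ} (ht : t ∈ nodes ord) : t < n := by
  induction h with
  | nil => simpa [nodes] using (by simpa [nodes] using ht : t = 0) ▸ hn
  | @cons ord t' p _ hlink _ _ ih =>
    simp only [nodes, List.map_cons, List.mem_cons] at ht ih
    rcases ht with h | rfl | h
    · exact ih (.inl h)
    · rcases hlink with h | h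
      · have := hl.2 _ h
        dsimp only at this
        omega
      · exact (hl.2 _ h).2
    · exact ih (.inr h)

/-- At every stage the nodes reached form a connected subtree containing the root. -/
theorem Grown.exists_walk {n : ℕ} {links ord : List (ℕ × ℕ)} (h : Grown links ord)
    (hn : 0 < n) {t : Fin n} (ht : t.val ∈ nodes ord) (hl : IsEdgeList n links) :
    ∃ w : (listGraph n links).Walk ⟨0, hn⟩ t, ∀ u ∈ w.support, u.val ∈ nodes ord := by
  induction h generalizing t with
  | nil =>
    obtain rfl : t = ⟨0, hn⟩ := Fin.ext (by simpa [nodes] using ht)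
    exact ⟨.nil, by simp [nodes]⟩
  | @cons ord s p hg hlink hs hp ih =>
    have hsub : ∀ u, u ∈ nodes ord → u ∈ nodes ((s, p) :: ord) := by
      intro u hu
      simp only [nodes, List.map_cons, List.mem_cons] at hu ⊢
      tauto
    by_cases hts : t.val = s
    · obtain ⟨w, hw⟩ := ih (t := ⟨p, hg.lt hl hn hp⟩) hp
      have hadj : (listGraph n links).Adj ⟨p, hg.lt hl hn hp⟩ t := by
        rw [listGraph, SimpleGraph.fromRel_adj]
        refine ⟨?_, ?_⟩
        · rintro rfl
          exact hs (hts ▸ hp)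
        · rw [hts]
          exact hlink.symm
      refine ⟨w.concat hadj, fun u hu => ?_⟩
      rw [SimpleGraph.Walk.support_concat, List.mem_append,
        List.mem_singleton] at hu
      rcases hu with hu | rfl
      · exact hsub _ (hw u hu)
      · exact ht
    · obtain ⟨w, hw⟩ := ih (t := t) (by
        simp only [nodes, List.map_cons, List.mem_cons] at ht ⊢
        tauto)
      exact ⟨w, fun u hu => hsub _ (hw u hu)⟩

theorem exists_walk_of_connected_induce {V : Type} {G : SimpleGraph V} {S : Set V}
    (h : (G.induce S).Connected) {s t : V} (hs : s ∈ S) (ht : t ∈ S) :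
    ∃ w : G.Walk s t, ∀ u ∈ w.support, u ∈ S := by
  obtain ⟨w⟩ := h.preconnected ⟨s, hs⟩ ⟨t, ht⟩
  have hw : ∀ u ∈ (w.map (SimpleGraph.Embedding.induce S).toHom).support, u ∈ S := by
    intro u hu
    rw [SimpleGraph.Walk.support_map] at hu
    obtain ⟨v, -, rfl⟩ := List.mem_map.1 hu
    exact v.2
  exact ⟨w.map (SimpleGraph.Embedding.induce S).toHom, hw⟩

/-- From the new node `t` one can step to its parent `p` and go on to `q` within the earlier nodes,
avoiding `t`. By acyclicity this is the only path from `t` to `q`, so the path through bags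
containing `v` also visits `p`. -/
theorem Grown.runningIntersection {n : ℕ} {links ord : List (ℕ × ℕ)} (h : Grown links ord)
    (hn : 0 < n) (hl : IsEdgeList n links) (hT : (listGraph n links).IsAcyclic)
    {X : ℕ → List ℕ}
    (hX : ∀ s t : Fin n, ∀ v, v ∈ X s → v ∈ X t →
      ∃ w : (listGraph n links).Walk s t, ∀ u ∈ w.support, v ∈ X u.val) :
    RunningIntersection X ord := by
  classical
  induction h with
  | nil => trivial
  | @cons ord t p hg hlink ht hp ih =>
    refine ⟨ih, ht, hp, fun q hq v hvt hvq => ?_⟩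
    have htn : t < n := (Grown.cons hg hlink ht hp).lt hl hn (by simp [nodes])
    have hpn : p < n := hg.lt hl hn hp
    have hqn : q < n := hg.lt hl hn hq
    obtain ⟨w₁, hw₁⟩ := hg.exists_walk hn (t := ⟨p, hpn⟩) hp hl
    obtain ⟨w₂, hw₂⟩ := hg.exists_walk hn (t := ⟨q, hqn⟩) hq hl
    obtain ⟨w, hw⟩ := hX ⟨t, htn⟩ ⟨q, hqn⟩ v hvt hvq
    have hadj : (listGraph n links).Adj ⟨t, htn⟩ ⟨p, hpn⟩ := by
      rw [listGraph, SimpleGraph.fromRel_adj]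
      refine ⟨fun h => ht ?_, hlink⟩
      rw [Fin.mk.injEq] at h
      exact h ▸ hp
    have hpath : (SimpleGraph.Walk.cons hadj (w₁.reverse.append w₂).bypass).IsPath := by
      rw [SimpleGraph.Walk.cons_isPath_iff]
      refine ⟨SimpleGraph.Walk.bypass_isPath _, fun hmem => ht ?_⟩
      have := SimpleGraph.Walk.support_bypass_subset_support _ hmem
      rw [SimpleGraph.Walk.mem_support_append_iff, SimpleGraph.Walk.support_reverse,
        List.mem_reverse] at this
      rcases this with h | h
      · exact hw₁ _ h
      · exact hw₂ _ h
    have heq := (hT.subsingleton_path _ _).elim ⟨_, hpath⟩ ⟨_, w.bypass_isPath⟩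
    rw [Subtype.mk.injEq] at heq
    have hmem : (⟨p, hpn⟩ : Fin n) ∈ w.bypass.support := by
      rw [← heq]
      simp
    exact hw _ (SimpleGraph.Walk.support_bypass_subset_support _ hmem)

/-- The Helly property of subtrees, by removing the last node. If every element of `C` also occurs
earlier, pairs that meet in the last bag meet in its parent's bag as well. Otherwise some element
occurs only in the last bag, and all others must meet it there. -/
theorem RunningIntersection.exists_subset {X : ℕ → List ℕ} {ord : List (ℕ × ℕ)}
    (h : RunningIntersection X ord) {C : List ℕ}
    (hC : ∀ u ∈ C, ∀ w ∈ C, ∃ t ∈ nodes ord, u ∈ X t ∧ w ∈ X t) :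
    ∃ t ∈ nodes ord, ∀ u ∈ C, u ∈ X t := by
  induction ord with
  | nil =>
    refine ⟨0, by simp [nodes], fun u hu => ?_⟩
    obtain ⟨t, ht, h, -⟩ := hC u hu u hu
    obtain rfl : t = 0 := by simpa [nodes] using ht
    exact h
  | cons e ord ih =>
    obtain ⟨hri, -, hp, hX⟩ := h
    have hnodes : ∀ j, j ∈ nodes (e :: ord) ↔ j = e.1 ∨ j ∈ nodes ord := by
      intro j
      simp [nodes]
      tauto
    by_cases hall : ∀ u ∈ C, ∃ t ∈ nodes ord, u ∈ X t
    · obtain ⟨t, ht, h⟩ := ih hri fun u hu w hw => by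
        obtain ⟨t, ht, hut, hwt⟩ := hC u hu w hw
        rcases (hnodes t).1 ht with rfl | ht
        · obtain ⟨i, hi, hui⟩ := hall u hu
          obtain ⟨j, hj, hwj⟩ := hall w hw
          exact ⟨e.2, hp, hX i hi u hut hui, hX j hj w hwt hwj⟩
        · exact ⟨t, ht, hut, hwt⟩
      exact ⟨t, (hnodes t).2 (.inr ht), h⟩
    · push Not at hall
      obtain ⟨u, hu, hall⟩ := hall
      refine ⟨e.1, (hnodes _).2 (.inl rfl), fun w hw => ?_⟩
      obtain ⟨t, ht, hut, hwt⟩ := hC u hu w hw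
      rcases (hnodes t).1 ht with rfl | ht
      · exact hwt
      · exact absurd hut (hall t ht)

/-! ### Splitting an instance along its tree decomposition -/

namespace GraphWithDecomposition

variable {x : GraphWithDecomposition} {ℓ : ℕ}

theorem Valid.bags_pos (hx : x.Valid ℓ) : 0 < x.bags.length :=
  have ⟨t⟩ := hx.decomposition.isTree.1.nonempty
  t.pos

theorem mem_bag {t : Fin x.bags.length} {v : Fin x.n} :
    v ∈ x.bag t ↔ v.val ∈ x.bags.getD t.val [] := by
  simp [bag, listSet]

theorem Valid.lt_of_mem_bag (hx : x.Valid ℓ) {t v : ℕ} (h : v ∈ x.bags.getD t []) : v < x.n := by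
  by_cases ht : t < x.bags.length
  · rw [List.getD_eq_getElem _ _ ht] at h
    exact (hx.bags_ok _ (List.getElem_mem ht)).2 v h
  · rw [List.getD_eq_default _ _ (not_lt.1 ht)] at h
    simp at h

theorem Valid.grown (_ : x.Valid ℓ) : Grown x.links (treeOrder x.bags x.links) := by
  rw [treeOrder_eq_iterate]
  exact Grown.nil.iterate _

theorem Valid.runningIntersection (hx : x.Valid ℓ) :
    RunningIntersection (fun t => x.bags.getD t []) (treeOrder x.bags x.links) := by
  refine hx.grown.runningIntersection hx.bags_pos hx.links_ok hx.decomposition.isTree.2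
    fun s t v hs ht => ?_
  have hv := hx.lt_of_mem_bag hs
  obtain ⟨w, hw⟩ := exists_walk_of_connected_induce (hx.decomposition.connected ⟨v, hv⟩)
    (s := s) (t := t) (mem_bag.2 hs) (mem_bag.2 ht)
  exact ⟨w, fun u hu => mem_bag.1 (hw u hu)⟩

theorem Valid.exists_bag (hx : x.Valid ℓ) {v : ℕ} (hv : v < x.n) :
    ∃ t ∈ nodes (treeOrder x.bags x.links), v ∈ x.bags.getD t [] := by
  obtain ⟨t, ht⟩ := hx.decomposition.vertex_mem ⟨v, hv⟩
  exact ⟨t, mem_nodes_treeOrder hx.decomposition.isTree.1 t, mem_bag.1 ht⟩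

theorem Valid.exists_bag_edge (hx : x.Valid ℓ) {e : ℕ × ℕ} (he : e ∈ x.edges) :
    ∃ t ∈ nodes (treeOrder x.bags x.links),
      e.1 ∈ x.bags.getD t [] ∧ e.2 ∈ x.bags.getD t [] := by
  have h := hx.edges_ok.2 e he
  obtain ⟨t, ht⟩ := hx.decomposition.edge_mem ⟨e.1, by omega⟩ ⟨e.2, by omega⟩
    ((listGraph_adj (fun e he => (hx.edges_ok.2 e he).1) h.1).2 he)
  exact ⟨t, mem_nodes_treeOrder hx.decomposition.isTree.1 t, mem_bag.1 ht.1, mem_bag.1 ht.2⟩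

/-- The non-isolated vertices. -/
def core (x : GraphWithDecomposition) : List ℕ := touched x.n x.edges

theorem mem_core {v : ℕ} : v ∈ x.core ↔ v < x.n ∧ ∃ e ∈ x.edges, v = e.1 ∨ v = e.2 := by
  simp [core, touched]

theorem core_sorted : x.core.Pairwise (· < ·) := List.Pairwise.filter _ List.pairwise_lt_range

theorem core_nodup : x.core.Nodup := List.Nodup.filter _ List.nodup_range

theorem Valid.ends_mem_core (hx : x.Valid ℓ) {e : ℕ × ℕ} (he : e ∈ x.edges) :
    e.1 ∈ x.core ∧ e.2 ∈ x.core := by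
  have h := hx.edges_ok.2 e he
  exact ⟨mem_core.2 ⟨by omega, e, he, .inl rfl⟩, mem_core.2 ⟨by omega, e, he, .inr rfl⟩⟩

theorem Valid.length_restrict_bag_le (hx : x.Valid ℓ) {t : ℕ}
    (ht : t ∈ nodes (treeOrder x.bags x.links)) :
    (restrict x.core (x.bags.getD t [])).length ≤ ℓ + 1 := by
  have htn := hx.grown.lt hx.links_ok hx.bags_pos ht
  have h1 : (x.bag ⟨t, htn⟩).card ≤ ℓ + 1 := by
    have h2 := hx.width_eq
    have h3 := Finset.le_sup (f := fun t => (x.bag t).card) (Finset.mem_univ ⟨t, htn⟩)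
    unfold width at h2
    omega
  have hn : (restrict x.core (x.bags.getD t [])).Nodup := core_nodup.filter _
  rw [← List.toFinset_card_of_nodup hn]
  refine (Finset.card_le_card fun v hv => ?_).trans
    ((Finset.card_image_le (f := Fin.val) (s := x.bag ⟨t, htn⟩)).trans h1)
  have hv := (mem_restrict.1 (List.mem_toFinset.1 hv)).2
  exact Finset.mem_image.2 ⟨⟨v, hx.lt_of_mem_bag hv⟩, mem_bag.2 hv, rfl⟩

theorem Valid.carve_spec (hx : x.Valid ℓ) {m M : ℕ} (hM : m + (ℓ + 1) ≤ M) (hm : 0 < m) :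
    ∃ P, carve x.core x.bags M (treeOrder x.bags x.links) = P.reverse ∧
      SplitsInto x.edges (ℓ + 1) m x.core.toFinset P ∧
      ∀ Y ∈ P, Y.Sublist x.core ∧ Y.length ≤ 2 * M := by
  have hlook : ∀ t, look x.core x.bags [] t = restrict x.core (x.bags.getD t []) := fun t => rfl
  obtain ⟨P, h1, h2, h3⟩ := TuringKernel.carve_spec (E := x.edges) (vs := x.core) (b := ℓ + 1)
    core_nodup hM hm (treeOrder x.bags x.links) [] [] hx.runningIntersection
    (fun t ht => hx.length_restrict_bag_le ht)
    -- With nothing stored yet, the sets are the bags restricted to the core, and the invariant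
    -- reduces to the axioms of a tree decomposition.
    { bag_subset := fun j _ v hv hvX => mem_restrict.2 ⟨hv, hvX⟩
      inter := fun j _ k _ _ v hv _ => (mem_restrict.1 hv).2
      edge := fun e he i _ j _ _ _ => by
        obtain ⟨t, ht, h1, h2⟩ := hx.exists_bag_edge he
        have h := hx.ends_mem_core he
        exact ⟨t, ht, mem_restrict.2 ⟨h.1, h1⟩, mem_restrict.2 ⟨h.2, h2⟩⟩
      sublist := fun j _ => List.filter_sublist
      length_lt := fun j hj => by
        have := hx.length_restrict_bag_le hj
        rw [hlook]
        omega }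
  refine ⟨P, by simpa [carve] using h1, ?_, h3⟩
  convert h2
  ext v
  rw [TuringKernel.mem_union, List.mem_toFinset]
  constructor
  · intro hv
    obtain ⟨t, ht, h⟩ := hx.exists_bag (mem_core.1 hv).1
    exact ⟨t, ht, mem_restrict.2 ⟨hv, h⟩⟩
  · rintro ⟨t, -, h⟩
    exact (mem_restrict.1 h).1

/-- Each set of the cover, restricted to the core, fits into one bag, and together these sets
exhaust the core because none of its vertices is isolated. -/
theorem Valid.length_core_le (hx : x.Valid ℓ) {L : List (List ℕ)} (hL : ListCover x.edges L) :
    x.core.length ≤ L.length * (ℓ + 1) := by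
  have hcard : ∀ C ∈ L.toFinset, (restrict x.core C).toFinset.card ≤ ℓ + 1 := by
    intro C hC
    rw [List.mem_toFinset] at hC
    obtain ⟨t, ht, h⟩ := hx.runningIntersection.exists_subset (C := restrict x.core C)
      fun u hu w hw => by
        rw [mem_restrict] at hu hw
        rcases lt_trichotomy u w with h | rfl | h
        · exact hx.exists_bag_edge (hL.clique C hC u hu.2 w hw.2 h)
        · obtain ⟨t, ht, h⟩ := hx.exists_bag (mem_core.1 hu.1).1
          exact ⟨t, ht, h, h⟩
        · obtain ⟨t, ht, h⟩ := hx.exists_bag_edge (hL.clique C hC w hw.2 u hu.2 h)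
          exact ⟨t, ht, h.symm⟩
    refine (Finset.card_le_card fun v hv => ?_).trans
      ((List.toFinset_card_le _).trans (hx.length_restrict_bag_le ht))
    rw [List.mem_toFinset] at hv ⊢
    exact mem_restrict.2 ⟨(mem_restrict.1 hv).1, h v hv⟩
  rw [← List.toFinset_card_of_nodup core_nodup]
  refine (Finset.card_le_card (t := L.toFinset.biUnion fun C => (restrict x.core C).toFinset)
    fun v hv => ?_).trans ((Finset.card_biUnion_le_card_mul _ _ _ hcard).trans
      (Nat.mul_le_mul_right _ (List.toFinset_card_le _)))
  rw [List.mem_toFinset] at hv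
  obtain ⟨-, e, he, hve⟩ := mem_core.1 hv
  obtain ⟨C, hC, h1, h2⟩ := hL.cover e he
  simp only [Finset.mem_biUnion, List.mem_toFinset, mem_restrict]
  refine ⟨C, hC, hv, ?_⟩
  rcases hve with rfl | rfl <;> assumption

/-- The pieces of the graph cost little more than the graph. -/
theorem Valid.sum_coverNumber_le (hx : x.Valid ℓ) {a : ℕ} (ha : 0 < a) :
    ∃ P, carve x.core x.bags (threshold a ℓ) (treeOrder x.bags x.links) = P ∧
      (∀ Y ∈ P, Y.Sublist x.core ∧ Y.length ≤ 2 * threshold a ℓ) ∧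
      (∀ e ∈ x.edges, ∃ Y ∈ P, e.1 ∈ Y ∧ e.2 ∈ Y) ∧
      a * (P.map fun Y => coverNumber (spanned x.edges Y)).sum ≤
        (a + 1) * coverNumber x.edges := by
  -- Chosen so that m = a · 2(ℓ+1)² · (ℓ+1): the loss per cut, times a, times the number of core
  -- vertices per clique. The threshold exceeds m by (ℓ+1)³, which leaves room for the overlap ℓ+1.
  obtain ⟨m, hm⟩ : ∃ m, m = 2 * a * ((ℓ + 1) * (ℓ + 1) * (ℓ + 1)) := ⟨_, rfl⟩
  have hm0 : 0 < m := by rw [hm]; positivity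
  have hM : m + (ℓ + 1) ≤ threshold a ℓ := by
    unfold threshold
    rw [hm]
    nlinarith [Nat.zero_le (ℓ * ℓ), Nat.zero_le (ℓ * ℓ * ℓ)]
  obtain ⟨P, hP, hS, hY⟩ := hx.carve_spec hM hm0
  have hlt : ∀ e ∈ x.edges, e.1 < e.2 := fun e he => (hx.edges_ok.2 e he).1
  obtain ⟨L, hL, hlen⟩ := exists_listCover hlt
  have h1 := hS.sum_coverNumber_le hx.edges_ok.1 hlt (L := L.map (restrict x.core))
    (fun C hC u hu v hv huv => by
      obtain ⟨D, hD, rfl⟩ := List.mem_map.1 hC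
      exact hL.clique D hD u (mem_restrict.1 hu).2 v (mem_restrict.1 hv).2 huv)
    (fun C hC v hv => by
      obtain ⟨D, hD, rfl⟩ := List.mem_map.1 hC
      exact List.mem_toFinset.2 (mem_restrict.1 hv).1)
    (fun e he h1 h2 => by
      rw [List.mem_toFinset] at h1 h2
      obtain ⟨C, hC, h⟩ := hL.cover e he
      exact ⟨_, List.mem_map_of_mem hC, mem_restrict.2 ⟨h1, h.1⟩, mem_restrict.2 ⟨h2, h.2⟩⟩)
  have h2 := hS.length_mul_le
  have h3 := hx.length_core_le hL
  rw [List.toFinset_card_of_nodup core_nodup] at h2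
  rw [List.length_map] at h1
  refine ⟨_, hP, by simpa using hY, fun e he => ?_, ?_⟩
  · have h := hx.ends_mem_core he
    obtain ⟨Y, hY, h⟩ := hS.exists_mem he (List.mem_toFinset.2 h.1) (List.mem_toFinset.2 h.2)
    exact ⟨Y, by simpa using hY, h⟩
  · rw [List.map_reverse, List.sum_reverse, ← hlen]
    obtain ⟨q, hq⟩ : ∃ q, P.length = q + 1 := hS.exists_length_eq
    rw [hq] at h1 h2
    generalize hB : 2 * ((ℓ + 1) * (ℓ + 1)) = B at h1
    -- The q cuts give q·m ≤ |core| ≤ (ℓ+1)·OPT, and the factor ℓ+1 cancels.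
    have h4 : a * (q * B) ≤ L.length := by
      subst hB
      refine Nat.le_of_mul_le_mul_right (c := ℓ + 1) ?_ (by omega)
      refine le_trans (le_of_eq ?_) ((by rw [add_mul] at h2; omega : q * m ≤ x.core.length).trans h3)
      rw [hm]
      ring
    have h5 : (P.map fun Y => coverNumber (spanned x.edges Y)).sum ≤ L.length + q * B := by
      rw [add_mul] at h1
      omega
    calc _ ≤ a * (L.length + q * B) := Nat.mul_le_mul_left a h5
      _ ≤ _ := by rw [mul_add, add_mul]; omega

end GraphWithDecomposition

/-! ## The queries -/

theorem rank_lt_length {Y : List ℕ} {v : ℕ} (hv : v ∈ Y) : rank Y v < Y.length := by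
  unfold rank
  rw [List.length_filter_lt_length_iff_exists]
  exact ⟨v, hv, by simp⟩

theorem rank_lt_rank {Y : List ℕ} {u v : ℕ} (hu : u ∈ Y) (huv : u < v) : rank Y u < rank Y v := by
  unfold rank
  have : (Y.filter fun w => decide (w < u)) =
      (Y.filter fun w => decide (w < v)).filter fun w => decide (w < u) := by
    rw [List.filter_filter]
    refine List.filter_congr fun w _ => ?_
    rw [Bool.eq_iff_iff]
    simp
    omega
  rw [this, List.length_filter_lt_length_iff_exists]
  exact ⟨u, by simp [hu, huv], by simp⟩

theorem getD_rank {Y : List ℕ} (hY : Y.Pairwise (· < ·)) {v : ℕ} (hv : v ∈ Y) :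
    Y.getD (rank Y v) 0 = v := by
  induction Y with
  | nil => simp at hv
  | cons a Y ih =>
    rw [List.pairwise_cons] at hY
    rcases List.mem_cons.1 hv with rfl | hv
    · have : (Y.filter fun u => decide (u < v)) = [] := by
        rw [List.filter_eq_nil_iff]
        intro u hu
        have := hY.1 u hu
        simp
        omega
      simp [rank, this]
    · have h := hY.1 v hv
      have h2 : rank (a :: Y) v = rank Y v + 1 := by simp [rank, h]
      rw [h2, List.getD_cons_succ, ih hY.2 hv]

/-- The subgraph induced by `Y`, with one bag. -/
def inducedGraph (E : List (ℕ × ℕ)) (Y : List ℕ) : GraphWithDecomposition where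
  n := Y.length
  edges := (spanned E Y).map fun e => (rank Y e.1, rank Y e.2)
  bags := [List.range Y.length]
  links := []

theorem raw_inducedGraph (E : List (ℕ × ℕ)) (Y : List ℕ) :
    (inducedGraph E Y).raw = induced E Y := by
  simp [GraphWithDecomposition.raw, inducedGraph, induced, ends]

theorem inducedGraph_valid {E : List (ℕ × ℕ)} {Y : List ℕ} (hE : E.Nodup)
    (hlt : ∀ e ∈ E, e.1 < e.2) (hY : Y.Pairwise (· < ·)) :
    (inducedGraph E Y).Valid (Y.length - 1) := by
  have hbag : ∀ t v, v ∈ (inducedGraph E Y).bag t := by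
    intro t v
    obtain rfl : t = ⟨0, by simp [inducedGraph]⟩ := Fin.ext (by
      have := t.isLt
      simp [inducedGraph] at this
      omega)
    simp [GraphWithDecomposition.bag, listSet, inducedGraph]
    exact Finset.mem_univ v
  have : Subsingleton (Fin (inducedGraph E Y).bags.length) := by
    simp only [inducedGraph, List.length_singleton]
    infer_instance
  have : Nonempty (Fin (inducedGraph E Y).bags.length) := ⟨⟨0, by simp [inducedGraph]⟩⟩
  refine ⟨⟨List.Nodup.map_on ?_ (hE.filter _), fun e he => ?_⟩, ?_, ⟨List.nodup_nil, by simp [inducedGraph]⟩,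
    ⟨.of_subsingleton, ?_, ?_, ?_⟩, ?_⟩
  · intro e he f hf h
    have he := (mem_spanned.1 he).2
    have hf := (mem_spanned.1 hf).2
    rw [Prod.mk.injEq] at h
    rw [Prod.ext_iff, ← getD_rank hY he.1, ← getD_rank hY he.2, h.1, h.2, getD_rank hY hf.1,
      getD_rank hY hf.2]
    exact ⟨rfl, rfl⟩
  · obtain ⟨f, hf, rfl⟩ := List.mem_map.1 he
    have hf := mem_spanned.1 hf
    exact ⟨rank_lt_rank hf.2.1 (hlt f hf.1), rank_lt_length hf.2.2⟩
  · intro b hb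
    obtain rfl := List.mem_singleton.1 hb
    exact ⟨List.nodup_range, fun v hv => List.mem_range.1 hv⟩
  · exact fun v => ⟨Classical.arbitrary _, hbag _ _⟩
  · exact fun u v _ => ⟨Classical.arbitrary _, hbag _ _, hbag _ _⟩
  · intro v
    have : Nonempty {t | v ∈ (inducedGraph E Y).bag t} := ⟨⟨Classical.arbitrary _, hbag _ _⟩⟩
    exact .of_subsingleton
  · have h : ∀ t, (inducedGraph E Y).bag t = Finset.univ :=
      fun t => Finset.eq_univ_iff_forall.2 (hbag t)
    simp only [width, h, Finset.card_univ, Fintype.card_fin,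
      Finset.sup_const Finset.univ_nonempty]
    rfl

/-- Relabelling by `rank` carries covers of the piece to covers of the query. Only this inequality
is needed; the converse direction is replaced by pulling back the answer itself. -/
theorem coverNumber_inducedGraph_le {E : List (ℕ × ℕ)} {Y : List ℕ} (hlt : ∀ e ∈ E, e.1 < e.2) :
    coverNumber (inducedGraph E Y).edges ≤ coverNumber (spanned E Y) := by
  obtain ⟨L, hL, hlen⟩ := exists_listCover (E := spanned E Y)
    fun e he => hlt e (mem_spanned.1 he).1
  rw [← hlen, ← List.length_map (f := fun C => (restrict Y C).map (rank Y))]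
  refine coverNumber_le ⟨fun C hC u hu v hv huv => ?_, fun e he => ?_⟩
  · obtain ⟨D, hD, rfl⟩ := List.mem_map.1 hC
    obtain ⟨a, ha, rfl⟩ := List.mem_map.1 hu
    obtain ⟨b, hb, rfl⟩ := List.mem_map.1 hv
    rw [mem_restrict] at ha hb
    have hab : a < b := by
      rcases lt_trichotomy a b with h | rfl | h
      · exact h
      · omega
      · have := rank_lt_rank hb.1 h
        omega
    exact List.mem_map.2 ⟨(a, b), hL.clique D hD a ha.2 b hb.2 hab, rfl⟩
  · obtain ⟨f, hf, rfl⟩ := List.mem_map.1 he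
    obtain ⟨C, hC, h⟩ := hL.cover f hf
    have hf := mem_spanned.1 hf
    exact ⟨_, List.mem_map_of_mem hC,
      List.mem_map_of_mem (mem_restrict.2 ⟨hf.2.1, h.1⟩),
      List.mem_map_of_mem (mem_restrict.2 ⟨hf.2.2, h.2⟩)⟩

/-- On a sorted list, indexing inverts `rank`. The default value 0 does no harm: two distinct
indices in a clique form an edge of the query, so both are in range. -/
theorem listCover_pullback {E : List (ℕ × ℕ)} {Y : List ℕ} (hlt : ∀ e ∈ E, e.1 < e.2)
    (hY : Y.Pairwise (· < ·)) {L : List (List ℕ)} (hL : ListCover (inducedGraph E Y).edges L) :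
    ListCover (spanned E Y) (L.map fun C => C.map fun i => Y.getD i 0) := by
  have hedge : ∀ i j, (i, j) ∈ (inducedGraph E Y).edges →
      (Y.getD i 0, Y.getD j 0) ∈ spanned E Y := by
    intro i j h
    obtain ⟨e, he, h⟩ := List.mem_map.1 h
    have he' := (mem_spanned.1 he).2
    rw [Prod.mk.injEq] at h
    rw [← h.1, ← h.2, getD_rank hY he'.1, getD_rank hY he'.2]
    exact he
  refine ⟨fun C hC u hu v hv huv => ?_, fun e he => ?_⟩
  · obtain ⟨D, hD, rfl⟩ := List.mem_map.1 hC
    obtain ⟨i, hi, rfl⟩ := List.mem_map.1 hu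
    obtain ⟨j, hj, rfl⟩ := List.mem_map.1 hv
    rcases lt_trichotomy i j with h | rfl | h
    · exact hedge i j (hL.clique D hD i hi j hj h)
    · omega
    · have := hlt _ (mem_spanned.1 (hedge j i (hL.clique D hD j hj i hi h))).1
      dsimp only at this
      omega
  · obtain ⟨C, hC, h⟩ := hL.cover (rank Y e.1, rank Y e.2) (List.mem_map.2 ⟨e, he, rfl⟩)
    have he' := (mem_spanned.1 he).2
    refine ⟨_, List.mem_map_of_mem hC, ?_, ?_⟩
    · rw [← getD_rank hY he'.1]
      exact List.mem_map_of_mem h.1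
    · rw [← getD_rank hY he'.2]
      exact List.mem_map_of_mem h.2

/-- A bound for the length of a query with `n` vertices. -/
noncomputable def queryBound : Polynomial ℕ :=
  (2 * .X + 1) + ((1 + .X * .X * (4 * .X + 6)) + ((1 + .X * (2 * .X + 2)) + 2 + 1 + 1) + 1) + 1

theorem len_induced_le {E : List (ℕ × ℕ)} (hE : E.Nodup) (Y : List ℕ) :
    len (induced E Y) ≤ queryBound.eval Y.length := by
  have h1 : (spanned E Y).length ≤ Y.length * Y.length :=
    (length_spanned_le hE Y).trans (Nat.mul_le_mul (List.toFinset_card_le _) (List.toFinset_card_le _))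
  -- An edge is a list of two ranks below `Y.length`, each of unary length at most 2|Y|+1, with
  -- three further nodes for the list.
  have h2 := len_le_of_forall
    (l := (spanned E Y).map fun e => [rank Y e.1, rank Y e.2]) (k := 4 * Y.length + 5)
    fun l hl => by
      obtain ⟨e, he, rfl⟩ := List.mem_map.1 hl
      have he := (mem_spanned.1 he).2
      have h1 := rank_lt_length he.1
      have h2 := rank_lt_length he.2
      simp
      omega
  have h3 := len_le_of_forall (l := List.range Y.length) (k := 2 * Y.length + 1) fun i hi => by
    rw [List.mem_range] at hi
    simp
    omega
  rw [List.length_map, Nat.add_assoc (4 * Y.length)] at h2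
  rw [List.length_range, Nat.add_assoc (2 * Y.length)] at h3
  simp only [Nat.reduceAdd] at h2 h3
  have h4 := Nat.mul_le_mul_right (4 * Y.length + 6) h1
  unfold induced queryBound
  simp only [len_pair, len_cons, len_nil, len_nat, Polynomial.eval_add, Polynomial.eval_mul,
    Polynomial.eval_X, Polynomial.eval_one, Polynomial.eval_ofNat]
  omega

/-! ## The program -/

/-- A program that puts queries to the oracle one after the other. -/
theorem exists_query_loop {δ ι κ α : Type} [Enc δ] [Enc ι] [Enc κ] [Enc α] :
    ∃ (p : Prog) (P : Polynomial ℕ), ∀ (O : Datum → Datum) (A : Datum → Prop) (c : δ)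
      (items : List (ι × κ)) (ans : ι × κ → α),
      (∀ it ∈ items, A (enc it.2) ∧ O (enc it.2) = enc (ans it) ∧ len (ans it) ≤ len it.2) →
      ∃ t, Runs O A p (enc (c, items, ([] : List (ι × α))))
        (enc (c, ([] : List (ι × κ)), (items.map fun it => (it.1, ans it)).reverse)) t ∧
        t ≤ P.eval (len (c, items, ([] : List (ι × α)))) := by
  have hb : PolyTime (fun y : δ × List (ι × κ) × List (ι × α) => y.2.1) := by fun_prop
  have h1 : PolyTime (fun y : δ × ((ι × κ) × List (ι × κ)) × List (ι × α) => y.1) := by fun_prop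
  have h2 : PolyTime (fun y : δ × ((ι × κ) × List (ι × κ)) × List (ι × α) => y.2.1.2) := by
    fun_prop
  have h3 : PolyTime (fun y : δ × ((ι × κ) × List (ι × κ)) × List (ι × α) => y.2.1.1.1) := by
    fun_prop
  have h4 : PolyTime (fun y : δ × ((ι × κ) × List (ι × κ)) × List (ι × α) => y.2.1.1.2) := by
    fun_prop
  have h5 : PolyTime (fun y : δ × ((ι × κ) × List (ι × κ)) × List (ι × α) => y.2.2) := by
    fun_prop
  obtain ⟨pb, Pb, hpb⟩ := hb
  obtain ⟨p1, P1, hp1⟩ := h1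
  obtain ⟨p2, P2, hp2⟩ := h2
  obtain ⟨p3, P3, hp3⟩ := h3
  obtain ⟨p4, P4, hp4⟩ := h4
  obtain ⟨p5, P5, hp5⟩ := h5
  let body : Prog := .pair p1 (.pair p2 (.pair (.pair p3 (.comp .query p4)) p5))
  let K : Polynomial ℕ := Pb + P1 + P2 + P3 + P4 + P5 + 6 * .X + 6
  refine ⟨.loop pb body, (.X + 1) * (2 * K.comp (2 * .X) + 2 * .X + 1),
    fun O A c items ans hitems => ?_⟩
  let N := len (c, items, ([] : List (ι × α)))
  -- An answer is no longer than its query, so the collected answers take no more room than the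
  -- items; together with the remaining items this stays below 2N.
  obtain ⟨t, ht, htK⟩ := PolyTime.runs_foldl (O := O) (A := A) (b := pb) (f := body) (c := c)
    (g := fun _ out it => (it.1, ans it) :: out) (S := 2 * N) (K := K.eval (2 * N))
    (p := fun it => A (enc it.2) ∧ O (enc it.2) = enc (ans it) ∧ len (ans it) ≤ len it.2)
    (fun l s h => by
      obtain ⟨t, ht, htP⟩ := hpb O A (c, l, s)
      refine ⟨t, ht, htP.trans ((eval_le_eval Pb h).trans ?_)⟩
      simp only [K, Polynomial.eval_add]
      omega)
    (fun it l s hit h => by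
      obtain ⟨t1, ht1, htP1⟩ := hp1 O A (c, (it, l), s)
      obtain ⟨t2, ht2, htP2⟩ := hp2 O A (c, (it, l), s)
      obtain ⟨t3, ht3, htP3⟩ := hp3 O A (c, (it, l), s)
      obtain ⟨t4, ht4, htP4⟩ := hp4 O A (c, (it, l), s)
      obtain ⟨t5, ht5, htP5⟩ := hp5 O A (c, (it, l), s)
      have hq := Runs.query (O := O) (enc it.2) hit.1
      have hq' : (O (enc it.2)).size ≤ len it.2 := by
        rw [hit.2.1]
        exact hit.2.2
      rw [hit.2.1] at hq
      refine ⟨_, ht1.pair (ht2.pair ((ht3.pair (ht4.comp hq)).pair ht5)), ?_⟩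
      have hS : len (c, (it, l), s) ≤ 2 * N := h
      have hle : len it.2 ≤ 2 * N := by
        obtain ⟨i, k⟩ := it
        simp only [len_pair] at hS ⊢
        omega
      have e1 := htP1.trans (eval_le_eval P1 hS)
      have e2 := htP2.trans (eval_le_eval P2 hS)
      have e3 := htP3.trans (eval_le_eval P3 hS)
      have e4 := htP4.trans (eval_le_eval P4 hS)
      have e5 := htP5.trans (eval_le_eval P5 hS)
      have e6 : (enc (c, (it, l), s)).size ≤ 2 * N := hS
      have e7 : (enc it.2).size ≤ 2 * N := hle
      have e8 : (enc (ans it)).size ≤ 2 * N := hit.2.2.trans hle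
      simp only [K, Polynomial.eval_add, Polynomial.eval_mul, Polynomial.eval_X,
        Polynomial.eval_ofNat]
      omega)
    items ([] : List (ι × α)) hitems
    (fun l₁ l₂ h => by
      have hf : ∀ (l : List (ι × κ)) (s : List (ι × α)), (∀ it ∈ l, len (ans it) ≤ len it.2) →
          len (l.foldl (fun out it => (it.1, ans it) :: out) s) + 1 ≤ len s + len l := by
        intro l
        induction l with
        | nil => simp
        | cons it l ih =>
          intro s hl
          have h1 := ih ((it.1, ans it) :: s) fun it hit => hl it (by simp [hit])
          have h2 := hl it (by simp)
          obtain ⟨i, k⟩ := it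
          simp only [List.foldl_cons, len_cons, len_pair] at h1 h2 ⊢
          omega
      have h1 := hf l₁ [] fun it hit => (hitems it (by simp [h, hit])).2.2
      have h2 : len l₁ ≤ len items := len_sublist (by simp [h])
      have h3 : len l₂ ≤ len items := len_sublist (by simp [h])
      simp only [N, len_pair, len_nil] at h1 ⊢
      omega)
  refine ⟨t, ?_, htK.trans ?_⟩
  · convert ht using 3
    simp
  · have h1 : items.length ≤ N := by
      have := length_le_len items
      simp only [N, len_pair]
      omega
    simp only [Polynomial.eval_add, Polynomial.eval_mul, Polynomial.eval_X, Polynomial.eval_one,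
      Polynomial.eval_ofNat, Polynomial.eval_comp]
    exact Nat.mul_le_mul_right _ (Nat.add_le_add_right h1 1)

/-! ## The kernel -/

theorem prepare_raw (a : ℕ) (x : GraphWithDecomposition) (ℓ : ℕ) :
    prepare a (x.raw, ℓ) = (x.edges,
      (carve x.core x.bags (threshold a ℓ) (treeOrder x.bags x.links)).map
        (fun Y => (Y, induced x.edges Y, Y.length - 1)), []) := by
  simp only [prepare, GraphWithDecomposition.raw, map_toPair_ends, GraphWithDecomposition.core]

/-! ### Size of the queried pieces -/

namespace GraphWithDecomposition.Valid

variable {x : GraphWithDecomposition} {ℓ : ℕ}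

/-- For ℓ = 0 the required bound on the vertices of a query is 0. It holds because bags of size one
carry no edge, so the only piece is empty. -/
theorem core_eq_nil (hx : x.Valid 0) : x.core = [] := by
  refine List.eq_nil_iff_forall_not_mem.2 fun v hv => ?_
  obtain ⟨-, e, he, -⟩ := mem_core.1 hv
  obtain ⟨t, ht, h1, h2⟩ := hx.exists_bag_edge he
  have h3 := hx.length_restrict_bag_le ht
  have h4 := hx.ends_mem_core he
  have h5 := (hx.edges_ok.2 e he).1
  have h6 : [e.1, e.2].Nodup := by simp; omega
  have h7 := (h6.subperm (l₂ := restrict x.core (x.bags.getD t [])) fun u hu => by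
    simp only [List.mem_cons, List.not_mem_nil, or_false] at hu
    rcases hu with rfl | rfl
    · exact mem_restrict.2 ⟨h4.1, h1⟩
    · exact mem_restrict.2 ⟨h4.2, h2⟩).length_le
  simp only [List.length_cons, List.length_nil] at h7
  omega

/-- For ℓ ≥ 1 one has ℓ+1 ≤ 2ℓ, and ε ≤ 1 gives ⌈1/ε⌉ ≤ 2/ε, so twice the threshold is at most 2 · 3
· (2/ε) · 8ℓ³ = 96ℓ³/ε. -/
theorem length_piece_le (hx : x.Valid ℓ) {ε : ℝ} (hε : 0 < ε) (hε1 : ε ≤ 1) {Y : List ℕ}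
    (hY : Y.Sublist x.core) (hlen : Y.length ≤ 2 * threshold ⌈1 / ε⌉₊ ℓ) :
    (Y.length : ℝ) ≤ 96 * ((ℓ : ℝ) ^ 4 / ε) := by
  rcases Nat.eq_zero_or_pos ℓ with rfl | hℓ
  · rw [hx.core_eq_nil] at hY
    rw [List.sublist_nil.1 hY]
    simp
  · have h1 : (1 : ℝ) ≤ 1 / ε := by
      rw [le_div_iff₀ hε]
      linarith
    have ha : (⌈1 / ε⌉₊ : ℝ) ≤ 2 / ε := by
      have := Nat.ceil_lt_add_one (le_trans zero_le_one h1)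
      have h2 : 2 / ε = 1 / ε + 1 / ε := by ring
      linarith
    have ha1 : (1 : ℝ) ≤ ⌈1 / ε⌉₊ := h1.trans (Nat.le_ceil _)
    have hl1 : (1 : ℝ) ≤ ℓ := by exact_mod_cast hℓ
    have h2 : (Y.length : ℝ) ≤ 2 * ((2 * ⌈1 / ε⌉₊ + 1) * ((ℓ + 1) * (ℓ + 1) * (ℓ + 1))) := by
      exact_mod_cast hlen
    have h3 : ((ℓ : ℝ) + 1) * (ℓ + 1) * (ℓ + 1) ≤ 2 * ℓ * (2 * ℓ) * (2 * ℓ) := by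
      gcongr <;> linarith
    calc (Y.length : ℝ) ≤ _ := h2
      _ ≤ 2 * ((3 * (2 / ε)) * (2 * ℓ * (2 * ℓ) * (2 * ℓ))) := by
        gcongr
        linarith
      _ = 96 * ((ℓ : ℝ) ^ 3 / ε) := by ring
      _ ≤ _ := by
        gcongr
        norm_num

end GraphWithDecomposition.Valid

theorem listCover_flatMap {E : List (ℕ × ℕ)} {P : List (List ℕ)} {L : List ℕ → List (List ℕ)}
    (hcov : ∀ e ∈ E, ∃ Y ∈ P, e.1 ∈ Y ∧ e.2 ∈ Y)
    (hL : ∀ Y ∈ P, ListCover (spanned E Y) (L Y)) : ListCover E (P.flatMap L) := by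
  refine ⟨fun C hC u hu v hv huv => ?_, fun e he => ?_⟩
  · obtain ⟨Y, hY, hC⟩ := List.mem_flatMap.1 hC
    exact (mem_spanned.1 ((hL Y hY).clique C hC u hu v hv huv)).1
  · obtain ⟨Y, hY, h⟩ := hcov e he
    obtain ⟨C, hC, h⟩ := (hL Y hY).cover e (mem_spanned.2 ⟨he, h⟩)
    exact ⟨C, List.mem_flatMap.2 ⟨Y, hY, hC⟩, h⟩

theorem sum_le_mul_sum {α : Type} (P : List α) (f g : α → ℕ) {c : ℝ}
    (h : ∀ Y ∈ P, (f Y : ℝ) ≤ c * g Y) : ((P.map f).sum : ℝ) ≤ c * (P.map g).sum := by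
  induction P with
  | nil => simp
  | cons Y P ih =>
    have h1 := h Y (by simp)
    have h2 := ih fun Z hZ => h Z (by simp [hZ])
    simp only [List.map_cons, List.sum_cons]
    rw [Nat.cast_add, Nat.cast_add, mul_add]
    linarith

end TuringKernel

/-! ### Assembly of the kernel -/

theorem mainTheorem3 :
    ∃ C : ℝ, ∀ ε : ℝ, 0 < ε → ε ≤ 1 →
      ∃ (p : TuringKernel.Prog) (f : Polynomial ℕ),
        TuringKernel.IsApproxTuringKernel TuringKernel.edgeCliqueCover (1 + ε)
          (fun ℓ I' ℓ' =>
            (∃ x : TuringKernel.GraphWithDecomposition,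
              I' = x.encode ∧ (x.n : ℝ) ≤ C * ((ℓ : ℝ) ^ 4 / ε)) ∧
            I'.size ≤ f.eval ℓ ∧ ℓ' ≤ f.eval ℓ)
          p := by
  open TuringKernel in
  refine ⟨96, fun ε hε hε1 => ?_⟩
  set a : ℕ := ⌈1 / ε⌉₊ with ha
  have ha0 : 0 < a := Nat.ceil_pos.2 (by positivity)
  obtain ⟨p₁, P₁, h₁⟩ := PolyTime.prepare a
  obtain ⟨p₂, P₂, h₂⟩ := exists_query_loop (δ := List (ℕ × ℕ)) (ι := List ℕ)
    (κ := RawGraph × ℕ) (α := List (List ℕ))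
  obtain ⟨p₃, P₃, h₃⟩ := PolyTime.finish
  let T : Polynomial ℕ := 2 * ((2 * Polynomial.C a + 1) *
    ((Polynomial.X + 1) * (Polynomial.X + 1) * (Polynomial.X + 1)))
  have hT : ∀ ℓ, T.eval ℓ = 2 * threshold a ℓ := fun ℓ => by simp [T, threshold]
  refine ⟨.comp p₃ (.comp p₂ p₁), queryBound.comp T + T,
    P₁.comp (2 * .X + 2) + P₂.comp (P₁.comp (2 * .X + 2)) +
      P₃.comp (P₂.comp (P₁.comp (2 * .X + 2))) + 2, fun c hc O hO I ℓ ⟨x, hI, hx⟩ => ?_⟩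
  subst hI
  obtain ⟨P, hP, hY, hcov, hsum⟩ := hx.sum_coverNumber_le ha0
  have hlt : ∀ e ∈ x.edges, e.1 < e.2 := fun e he => (hx.edges_ok.2 e he).1
  have hsorted : ∀ Y ∈ P, Y.Pairwise (· < ·) := fun Y hYP =>
    x.core_sorted.sublist (hY Y hYP).1
  have hvalid : ∀ Y ∈ P, (inducedGraph x.edges Y).Valid (Y.length - 1) := fun Y hYP =>
    inducedGraph_valid hx.edges_ok.1 hlt (hsorted Y hYP)
  -- The answers become a function of the piece. Their length bound comes from the length
  -- restriction on solutions of the query.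
  have hans : ∀ Y : List ℕ, ∃ L : List (List ℕ), Y ∈ P →
      O (enc (induced x.edges Y, Y.length - 1)) = enc L ∧
      len L ≤ len (induced x.edges Y, Y.length - 1) ∧
      ListCover (inducedGraph x.edges Y).edges L ∧
      (L.length : ℝ) ≤ c * coverNumber (inducedGraph x.edges Y).edges := by
    intro Y
    by_cases hYP : Y ∈ P
    · have h := hO _ _ ⟨_, rfl, hvalid Y hYP⟩
      rw [GraphWithDecomposition.input_eq, raw_inducedGraph,
        isApproxSolution_iff (hvalid Y hYP)] at h
      obtain ⟨hs, L, hL, -, hcover, hle⟩ := h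
      refine ⟨L, fun _ => ⟨hL, ?_, hcover, hle⟩⟩
      rw [hL, GraphWithDecomposition.encode_eq, raw_inducedGraph] at hs
      have h1 : len L ≤ len (induced x.edges Y) + (Y.length - 1) := hs
      simp only [len_pair, len_nat]
      omega
    · exact ⟨[], fun h => absurd h hYP⟩
  choose ans hans using hans
  set A : Datum → Prop := fun q => ∃ I' k', q = input I' k' ∧ edgeCliqueCover.IsInstance I' k' ∧
    (∃ y : GraphWithDecomposition, I' = y.encode ∧ (y.n : ℝ) ≤ 96 * ((ℓ : ℝ) ^ 4 / ε)) ∧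
      I'.size ≤ (queryBound.comp T + T).eval ℓ ∧ k' ≤ (queryBound.comp T + T).eval ℓ with hA
  have hquery : ∀ Y ∈ P, A (enc (induced x.edges Y, Y.length - 1)) := by
    intro Y hYP
    have hlen : Y.length ≤ T.eval ℓ := (hT ℓ).symm ▸ (hY Y hYP).2
    refine ⟨(inducedGraph x.edges Y).encode, Y.length - 1, ?_, ⟨_, rfl, hvalid Y hYP⟩,
      ⟨_, rfl, hx.length_piece_le hε hε1 (hY Y hYP).1 (hY Y hYP).2⟩, ?_, ?_⟩
    · rw [GraphWithDecomposition.input_eq, raw_inducedGraph]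
    · rw [GraphWithDecomposition.encode_eq, raw_inducedGraph]
      have h1 := (len_induced_le hx.edges_ok.1 Y).trans (eval_le_eval queryBound hlen)
      rw [Polynomial.eval_add, Polynomial.eval_comp]
      exact h1.trans (Nat.le_add_right _ _)
    · rw [Polynomial.eval_add]
      omega
  obtain ⟨t₁, ht₁, hP₁⟩ := h₁ O A (x.raw, ℓ)
  rw [prepare_raw, hP] at ht₁
  obtain ⟨t₂, ht₂, hP₂⟩ := h₂ O A x.edges
    (P.map fun Y => (Y, induced x.edges Y, Y.length - 1)) (fun it => ans it.1) (fun it hit => by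
      obtain ⟨Y, hYP, rfl⟩ := List.mem_map.1 hit
      exact ⟨hquery Y hYP, (hans Y hYP).1, (hans Y hYP).2.1⟩)
  obtain ⟨t₃, ht₃, hP₃⟩ := h₃ O A (x.edges, ([] : List (List ℕ × RawGraph × ℕ)),
    ((P.map fun Y => (Y, induced x.edges Y, Y.length - 1)).map
      fun it => (it.1, ans it.1)).reverse)
  have hfin : finish (x.edges, ([] : List (List ℕ × RawGraph × ℕ)),
      ((P.map fun Y => (Y, induced x.edges Y, Y.length - 1)).map
        fun it => (it.1, ans it.1)).reverse) = shrink x.edges (P.reverse.flatMap fun Y =>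
          (ans Y).map fun C => C.map fun i => Y.getD i 0) := by
    simp [finish, ← List.map_reverse, List.flatMap_map]
  rw [hfin] at ht₃
  refine ⟨_, _, (x.input_eq ℓ).symm ▸ (ht₁.comp ht₂).comp ht₃, ?_, ?_⟩
  -- The parameter is written in unary with 2ℓ+1 nodes, hence the factor 2. The time bounds of the
  -- three stages are then nested, none of them depending on c or the oracle.
  · have e0 : len (x.raw, ℓ) ≤ 2 * (x.encode.size + ℓ) + 2 := by
      have : x.encode.size = len x.raw := by rw [x.encode_eq]; rfl
      simp only [len_pair, len_nat]
      omega
    have e1 := hP₁.trans (eval_le_eval P₁ e0)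
    have e2 := hP₂.trans (eval_le_eval P₂ (ht₁.size_le.trans e1))
    have e3 := hP₃.trans (eval_le_eval P₃ (ht₂.size_le.trans e2))
    simp only [Polynomial.eval_add, Polynomial.eval_mul, Polynomial.eval_comp, Polynomial.eval_X,
      Polynomial.eval_ofNat]
    omega
  · have hcover : ListCover x.edges (P.reverse.flatMap fun Y =>
        (ans Y).map fun C => C.map fun i => Y.getD i 0) :=
      listCover_flatMap (fun e he => by simpa using hcov e he) fun Y hYP => by
        rw [List.mem_reverse] at hYP
        exact listCover_pullback hlt (hsorted Y hYP) (hans Y hYP).2.2.1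
    rw [isApproxSolution_iff hx]
    refine ⟨?_, _, rfl, fun C hC v hv => ?_, hcover.shrink, ?_⟩
    · have h1 := len_shrink_le x.edges (P.reverse.flatMap fun Y =>
        (ans Y).map fun C => C.map fun i => Y.getD i 0)
      rw [← len_ends] at h1
      exact h1.trans (len_ends_edges_le.trans (Nat.le_add_right _ _))
    · obtain ⟨e, he, h⟩ := mem_shrink hC hv
      have := hx.edges_ok.2 e he
      omega
    · have h1 := length_shrink_le x.edges (P.reverse.flatMap fun Y =>
        (ans Y).map fun C => C.map fun i => Y.getD i 0)
      have h2 : (P.reverse.flatMap fun Y =>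
          (ans Y).map fun C => C.map fun i => Y.getD i 0).length =
            (P.map fun Y => (ans Y).length).sum := by
        simp [List.length_flatMap, List.map_reverse, List.sum_reverse]
      have h3 : ((P.map fun Y => (ans Y).length).sum : ℝ) ≤
          c * (P.map fun Y => coverNumber (spanned x.edges Y)).sum :=
        sum_le_mul_sum P _ _ fun Y hYP => (hans Y hYP).2.2.2.trans (by
          gcongr
          exact coverNumber_inducedGraph_le hlt)
      have h4 : (a : ℝ) * (P.map fun Y => coverNumber (spanned x.edges Y)).sum ≤
          (a + 1) * coverNumber x.edges := by exact_mod_cast hsum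
      -- This turns the factor (a+1)/a into at most 1+ε.
      have haε : 1 ≤ ε * a := by
        have := Nat.le_ceil (1 / ε)
        rw [div_le_iff₀ hε] at this
        linarith
      have h5 : ((P.map fun Y => coverNumber (spanned x.edges Y)).sum : ℝ) ≤
          (1 + ε) * coverNumber x.edges := by
        have ha0' : (0 : ℝ) < a := by exact_mod_cast ha0
        refine le_of_mul_le_mul_left (h4.trans ?_) ha0'
        calc ((a : ℝ) + 1) * coverNumber x.edges ≤ (a + ε * a) * coverNumber x.edges := by gcongr
          _ = _ := by ring
      calc ((shrink x.edges _).length : ℝ) ≤ (P.map fun Y => (ans Y).length).sum := by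
            rw [← h2]
            exact_mod_cast h1
        _ ≤ _ := h3
        _ ≤ c * ((1 + ε) * coverNumber x.edges) := by gcongr
        _ = _ := by ring
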